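/- **Setting.** The core language has types $\tau ::= \hat i \mid I \mid \forall A.\tau \mid \tau\,\tau' \mid \tau\to\tau'$ and expressions $e ::= \bar i \mid \lambda x{:}\tau.e \mid \Lambda A.e \mid \mathtt{let}\ x{:}\tau=e_1\ \mathtt{in}\ e_2 \mid e_1\,e_2 \mid \mathtt{case}\ e: I\,\tau_1\ldots\tau_n\ \mathtt{return}\ \sigma\ \mathtt{of}\ p_1\to e_1;\ldots;p_m\to e_m \mid C_I \mid \mathtt{fix}\ f\,x:\tau_1\to\tau_2=e \mid \tau$, with patterns $p ::= C\,x_1\ldots x_k$. Here $\hat i$ and $\bar i$ are de Bruijn indices, which count type variables and term variables in one common context. A global environment $\Sigma$ is a list of definitions of inductive types, each given by a name, a number of parameters and a list of constructors; a constructor has a name and a list of argument types. $\Sigma$ is *well-formed* if in every definition with $n$ parameters the argument types of all constructors have no free variables other than the $n$ parameters. An expression is *closed* if it has no free (term or type) variables. Values are $v ::= C_I(v_1,\ldots,v_n) \mid \mathrm{clos}(\rho,\lambda x{:}\tau.e) \mid \mathrm{clos}(\rho,\mathtt{fix}\ f\,x:\tau_1\to\tau_2=e) \mid \mathrm{clos}(\rho,\Lambda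 A.e) \mid \tau$, where $\rho$ is a list of values. The interpreter $\mathrm{eval}^n_{\Sigma,\rho}(e)$ is a call-by-value, environment-passing definitional interpreter with fuel $n$ that returns $\mathtt{Ok}\ v$, $\mathtt{NotEnoughFuel}$ or $\mathtt{EvalError}$. It evaluates the argument of an application before the function. It evaluates the type annotations it meets by substituting the types found in $\rho$, and fails if there is no type for a variable or if anything but an inductive type is applied to an argument. Before it builds a closure or enters a $\mathtt{case}$, it checks that all type variables of the body or of the branches which have an entry in $\rho$ refer to types. It applies a $\mathtt{fix}$ only to constructor values. In a $\mathtt{case}$ on a value $C_{I'}(\mathit{args})$ it requires $I'=I$, the number of parameters to agree with the definition of $I$, and the number of arguments (without the parameters) to agree with both the pattern and the definition of $C$; the body of the first branch for $C$ is then evaluated with these arguments pushed onto $\rho$. The read-back $|v|$ of a value is the expression obtained by applying $C_I$ to the read-backs of its arguments, respectively by the parallel substitution of the read-backs of the entries of $\rho$ into the abstraction stored in a closure; a type value is read back as itself. Since type variables and term variables share one environment, $|v|$ is a priori partial: it is undefined if a type variable is to be replaced by an expression that is not a type. The translation $[\![e]\!]_\Sigma$ to the terms of PCUIC (the calculus formalised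 in MetaCoq) sends $\bar i,\hat i$ to the index $i$, abstractions, $\mathtt{let}$ and application to their counterparts, $\Lambda A$ and $\forall A$ to binders over $\mathtt{Set}$, $\tau\to\sigma$ to a non-dependent product, $C_I$ to the constructor of $I$ whose number is the position of $C$ in the definition of $I$, $\mathtt{fix}$ to a fixpoint whose body is a $\lambda$-abstraction, and $\mathtt{case}$ to a $\mathtt{match}$ with one branch for each constructor, in the order of the definition of $I$; a branch is an iterated $\lambda$-abstraction over the arguments of the constructor, whose types are instantiated with the translated parameters. Where a name is not found, a branch is missing or a number of parameters or pattern variables is wrong, a term that does not evaluate takes the place. $t\Downarrow t'$ denotes the weak call-by-value evaluation relation of MetaCoq in the empty local context and an arbitrary MetaCoq global environment. **Theorem (soundness for closed expressions).** For every closed expression $e$, every number of steps $n$, every well-formed global environment $\Sigma$ and every value $v$: if $\mathrm{eval}^n_{\Sigma,[\,]}(e)=\mathtt{Ok}\ v$, then $|v|$ is defined and $$[\![e]\!]_\Sigma \Downarrow [\![\,|v|\,]\!]_\Sigma .$$ -/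

import Mathlib

/-! Types, expressions and global environments of the core language, in de Bruijn form. -/

namespace Acorn

/-- Types. `tyRel i` is a type variable, given by its de Bruijn index; the strings stored at
binders are only decoration. Type variables and term variables are counted in one context. -/
inductive Ty where
  | tyInd (I : String)
  | tyForall (A : String) (τ : Ty)
  | tyApp (τ₁ τ₂ : Ty)
  | tyRel (i : ℕ)
  | tyArr (τ₁ τ₂ : Ty)

/-- A pattern `C x₁ … xₙ`. -/
structure Pat where
  ctor : String
  vars : List String

/-- Expressions. A branch of `eCase` binds the variables of its pattern, the last variable of the
pattern being index `0`. `eFix f x τ₁ τ₂ e` binds two variables in `e`: index `1` is the recursive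
call and index `0` is the argument. -/
inductive Expr where
  | eRel (i : ℕ)
  | eLambda (x : String) (τ : Ty) (e : Expr)
  | eTyLam (A : String) (e : Expr)
  | eLetIn (x : String) (τ : Ty) (e₁ e₂ : Expr)
  | eApp (e₁ e₂ : Expr)
  | eCase (e : Expr) (I : String) (params : List Ty) (σ : Ty) (bs : List (Pat × Expr))
  | eConstr (I C : String)
  | eFix (f x : String) (τ₁ τ₂ : Ty) (e : Expr)
  | eTy (τ : Ty)

/-- A constructor: a name and the list of its argument types. The argument types refer to the
parameters of the inductive type as if these were bound on top of each type: with `n` parameters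
the first one is index `n - 1` and the last one is index `0`. -/
structure Ctor where
  name : String
  args : List Ty

/-- The definition of an inductive type: name, number of parameters, constructors. -/
structure IndDecl where
  name : String
  nparams : ℕ
  ctors : List Ctor

abbrev GlobalEnv := List IndDecl

/-- The (first) definition of the inductive type `I`. -/
def resolveInd (G : GlobalEnv) (I : String) : Option IndDecl :=
  G.find? fun d => d.name == I

/-- The position of the (first) constructor called `C`, and the constructor itself. -/
def findCtor : List Ctor → String → Option (ℕ × Ctor)
  | [], _ => none
  | c :: cs, C =>
    if c.name = C then some (0, c) else (findCtor cs C).map fun r => (r.1 + 1, r.2)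

/-- The number of parameters of the inductive type `I`, the position of `C` in its list of
constructors, and the constructor itself. -/
def resolveConstr (G : GlobalEnv) (I C : String) : Option (ℕ × ℕ × Ctor) :=
  match resolveInd G I with
  | none => none
  | some d => (findCtor d.ctors C).map fun r => (d.nparams, r.1, r.2)

/-! Closedness. -/

/-- All free variables of the type are below `n`. -/
def Ty.closedAt : ℕ → Ty → Bool
  | _, .tyInd _ => true
  | n, .tyForall _ τ => τ.closedAt (n + 1)
  | n, .tyApp τ₁ τ₂ => τ₁.closedAt n && τ₂.closedAt n
  | n, .tyRel i => decide (i < n)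
  | n, .tyArr τ₁ τ₂ => τ₁.closedAt n && τ₂.closedAt n

mutual

/-- All free variables of the expression (term and type variables) are below `n`. -/
def Expr.closedAt (n : ℕ) : Expr → Bool
  | .eRel i => decide (i < n)
  | .eLambda _ τ e => τ.closedAt n && e.closedAt (n + 1)
  | .eTyLam _ e => e.closedAt (n + 1)
  | .eLetIn _ τ e₁ e₂ => τ.closedAt n && e₁.closedAt n && e₂.closedAt (n + 1)
  | .eApp e₁ e₂ => e₁.closedAt n && e₂.closedAt n
  | .eCase e _ params σ bs =>
    e.closedAt n && params.all (Ty.closedAt n) && σ.closedAt n && branchesClosedAt n bs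
  | .eConstr _ _ => true
  | .eFix _ _ τ₁ τ₂ e => τ₁.closedAt n && τ₂.closedAt n && e.closedAt (n + 2)
  | .eTy τ => τ.closedAt n

def branchesClosedAt (n : ℕ) : List (Pat × Expr) → Bool
  | [] => true
  | b :: bs => branchClosedAt n b && branchesClosedAt n bs

def branchClosedAt (n : ℕ) : Pat × Expr → Bool
  | (p, e) => e.closedAt (n + p.vars.length)

end

def Expr.Closed (e : Expr) : Prop := e.closedAt 0 = true

/-- A global environment is well-formed if the argument types of every constructor of every
definition have no free variables apart from the parameters of the definition. -/
def GlobalEnv.WellFormed (G : GlobalEnv) : Prop :=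
  ∀ d ∈ G, ∀ c ∈ d.ctors, ∀ σ ∈ c.args, σ.closedAt d.nparams = true

/-! Values and the interpreter. -/

/-- Values. Environments are lists, the entry at position `i` belonging to index `i`. -/
inductive Val where
  | vConstr (I C : String) (args : List Val)
  | vClosLam (ρ : List Val) (x : String) (τ : Ty) (e : Expr)
  | vClosFix (ρ : List Val) (f x : String) (τ₁ τ₂ : Ty) (e : Expr)
  | vTyClos (ρ : List Val) (A : String) (e : Expr)
  | vTy (τ : Ty)

inductive Failure where
  | notEnoughFuel
  | evalError

/-- The error monad of the interpreter. -/
abbrev Res := Except Failure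

def evalError {α : Type} : Res α := .error .evalError

/-- The type is an inductive type, possibly applied to some arguments. -/
def Ty.isIndApp : Ty → Bool
  | .tyInd _ => true
  | .tyApp τ _ => τ.isIndApp
  | _ => false

/-- Evaluation of types: substitute the types found in `ρ` for the type variables (`k` is the
number of binders passed). It fails when there is no type in `ρ` for a variable, and when
something else than an inductive type is applied. Type values are closed, so that they need no
lifting. -/
def evalType (ρ : List Val) : ℕ → Ty → Res Ty
  | _, .tyInd I => pure (.tyInd I)
  | k, .tyForall A τ => do
    let τ' ← evalType ρ (k + 1) τ
    pure (.tyForall A τ')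
  | k, .tyApp τ₁ τ₂ => do
    let τ₂' ← evalType ρ k τ₂
    let τ₁' ← evalType ρ k τ₁
    if τ₁'.isIndApp then pure (.tyApp τ₁' τ₂') else evalError
  | k, .tyRel i =>
    if k ≤ i then
      match ρ[i - k]? with
      | some (.vTy τ) => pure τ
      | _ => evalError
    else pure (.tyRel i)
  | k, .tyArr τ₁ τ₂ => do
    let τ₂' ← evalType ρ k τ₂
    let τ₁' ← evalType ρ k τ₁
    pure (.tyArr τ₁' τ₂')

/-- Below `k` binders, whenever `ρ` has an entry for a type variable of the type, this entry is
a type. -/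
def Ty.validIn (ρ : List Val) : ℕ → Ty → Bool
  | _, .tyInd _ => true
  | k, .tyForall _ τ => τ.validIn ρ (k + 1)
  | k, .tyApp τ₁ τ₂ => τ₁.validIn ρ k && τ₂.validIn ρ k
  | k, .tyRel i =>
    if k ≤ i then
      match ρ[i - k]? with
      | none => true
      | some (.vTy _) => true
      | some _ => false
    else true
  | k, .tyArr τ₁ τ₂ => τ₁.validIn ρ k && τ₂.validIn ρ k

mutual

/-- Below `k` binders, whenever `ρ` has an entry for a type variable of the expression, this entry
is a type. -/
def Expr.validIn (ρ : List Val) (k : ℕ) : Expr → Bool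
  | .eRel _ => true
  | .eLambda _ τ e => τ.validIn ρ k && e.validIn ρ (k + 1)
  | .eTyLam _ e => e.validIn ρ (k + 1)
  | .eLetIn _ τ e₁ e₂ => τ.validIn ρ k && e₁.validIn ρ k && e₂.validIn ρ (k + 1)
  | .eApp e₁ e₂ => e₁.validIn ρ k && e₂.validIn ρ k
  | .eCase e _ params σ bs =>
    e.validIn ρ k && params.all (Ty.validIn ρ k) && σ.validIn ρ k && branchesValidIn ρ k bs
  | .eConstr _ _ => true
  | .eFix _ _ τ₁ τ₂ e => τ₁.validIn ρ k && τ₂.validIn ρ k && e.validIn ρ (k + 2)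
  | .eTy τ => τ.validIn ρ k

def branchesValidIn (ρ : List Val) (k : ℕ) : List (Pat × Expr) → Bool
  | [] => true
  | b :: bs => branchValidIn ρ k b && branchesValidIn ρ k bs

def branchValidIn (ρ : List Val) (k : ℕ) : Pat × Expr → Bool
  | (p, e) => e.validIn ρ (k + p.vars.length)

end

def validate (ρ : List Val) (k : ℕ) (e : Expr) : Res Unit :=
  if e.validIn ρ k then pure () else evalError

def validateBranches (ρ : List Val) (bs : List (Pat × Expr)) : Res Unit :=
  if branchesValidIn ρ 0 bs then pure () else evalError

def Val.isConstr : Val → Bool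
  | .vConstr _ _ _ => true
  | _ => false

/-- The body of the (first) branch for the constructor `C`. The arguments of a constructor value
start with the `nparam` parameters of the inductive type, which patterns do not mention. -/
def matchPat (C : String) (nparam : ℕ) (tys : List Ty) (args : List Val)
    (bs : List (Pat × Expr)) : Res Expr :=
  match bs.find? fun b => b.1.ctor == C with
  | none => evalError
  | some (p, e) =>
    if args.length = nparam + p.vars.length ∧ args.length = nparam + tys.length then pure e
    else evalError

/-- The definitional interpreter; the natural number is the fuel. -/
def eval (G : GlobalEnv) : ℕ → List Val → Expr → Res Val
  | 0, _, _ => .error .notEnoughFuel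
  | n + 1, ρ, e =>
    match e with
    | .eRel i =>
      match ρ[i]? with
      | some v => pure v
      | none => evalError
    | .eLambda x τ b => do
      let τ' ← evalType ρ 0 τ
      validate ρ 1 b
      pure (.vClosLam ρ x τ' b)
    | .eTyLam A b => do
      validate ρ 1 b
      pure (.vTyClos ρ A b)
    | .eLetIn _ τ e₁ e₂ => do
      let _ ← evalType ρ 0 τ
      let v₁ ← eval G n ρ e₁
      eval G n (v₁ :: ρ) e₂
    | .eApp e₁ e₂ => do
      let v₂ ← eval G n ρ e₂
      let v₁ ← eval G n ρ e₁
      match v₁ with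
      | .vConstr I C args => pure (.vConstr I C (args ++ [v₂]))
      | .vClosLam ρ' _ _ b => eval G n (v₂ :: ρ') b
      | .vClosFix ρ' _ _ _ _ b =>
        if v₂.isConstr then eval G n (v₂ :: v₁ :: ρ') b else evalError
      | .vTyClos ρ' _ b => eval G n (v₂ :: ρ') b
      | .vTy _ => evalError
    | .eCase e I params σ bs => do
      validateBranches ρ bs
      let _ ← evalType ρ 0 σ
      let _ ← params.mapM (evalType ρ 0)
      let v ← eval G n ρ e
      match v with
      | .vConstr I' C args =>
        match resolveConstr G I' C with
        | some (nparam, _, c) =>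
          if I = I' ∧ params.length = nparam then do
            let b ← matchPat C nparam c.args args bs
            eval G n ((args.drop nparam).reverse ++ ρ) b
          else evalError
        | none => evalError
      | _ => evalError
    | .eConstr I C =>
      match resolveConstr G I C with
      | some _ => pure (.vConstr I C [])
      | none => evalError
    | .eFix f x τ₁ τ₂ b => do
      let τ₁' ← evalType ρ 0 τ₁
      let τ₂' ← evalType ρ 0 τ₂
      validate ρ 2 b
      pure (.vClosFix ρ f x τ₁' τ₂' b)
    | .eTy τ => do
      let τ' ← evalType ρ 0 τ
      pure (.vTy τ')

/-! Parallel substitution of environments of (closed) expressions, and the conversion of values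
back to expressions. Substitution is partial: it is undefined when a type variable refers to an
expression which is not a type. -/

def Ty.substEnv (ρ : List Expr) : ℕ → Ty → Option Ty
  | _, .tyInd I => some (.tyInd I)
  | k, .tyForall A τ => do
    let τ' ← τ.substEnv ρ (k + 1)
    some (.tyForall A τ')
  | k, .tyApp τ₁ τ₂ => do
    let τ₁' ← τ₁.substEnv ρ k
    let τ₂' ← τ₂.substEnv ρ k
    some (.tyApp τ₁' τ₂')
  | k, .tyRel i =>
    if k ≤ i then
      match ρ[i - k]? with
      | some (.eTy τ) => some τ
      | some _ => none
      | none => some (.tyRel (i - ρ.length))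
    else some (.tyRel i)
  | k, .tyArr τ₁ τ₂ => do
    let τ₁' ← τ₁.substEnv ρ k
    let τ₂' ← τ₂.substEnv ρ k
    some (.tyArr τ₁' τ₂')

mutual

def Expr.substEnv (ρ : List Expr) (k : ℕ) : Expr → Option Expr
  | .eRel i =>
    if k ≤ i then
      match ρ[i - k]? with
      | some e => some e
      | none => some (.eRel (i - ρ.length))
    else some (.eRel i)
  | .eLambda x τ e => do
    let τ' ← τ.substEnv ρ k
    let e' ← e.substEnv ρ (k + 1)
    some (.eLambda x τ' e')
  | .eTyLam A e => do
    let e' ← e.substEnv ρ (k + 1)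
    some (.eTyLam A e')
  | .eLetIn x τ e₁ e₂ => do
    let τ' ← τ.substEnv ρ k
    let e₁' ← e₁.substEnv ρ k
    let e₂' ← e₂.substEnv ρ (k + 1)
    some (.eLetIn x τ' e₁' e₂')
  | .eApp e₁ e₂ => do
    let e₁' ← e₁.substEnv ρ k
    let e₂' ← e₂.substEnv ρ k
    some (.eApp e₁' e₂')
  | .eCase e I params σ bs => do
    let e' ← e.substEnv ρ k
    let params' ← params.mapM (Ty.substEnv ρ k)
    let σ' ← σ.substEnv ρ k
    let bs' ← substEnvBranches ρ k bs
    some (.eCase e' I params' σ' bs')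
  | .eConstr I C => some (.eConstr I C)
  | .eFix f x τ₁ τ₂ e => do
    let τ₁' ← τ₁.substEnv ρ k
    let τ₂' ← τ₂.substEnv ρ k
    let e' ← e.substEnv ρ (k + 2)
    some (.eFix f x τ₁' τ₂' e')
  | .eTy τ => do
    let τ' ← τ.substEnv ρ k
    some (.eTy τ')

def substEnvBranches (ρ : List Expr) (k : ℕ) : List (Pat × Expr) → Option (List (Pat × Expr))
  | [] => some []
  | b :: bs => do
    let b' ← substEnvBranch ρ k b
    let bs' ← substEnvBranches ρ k bs
    some (b' :: bs')

def substEnvBranch (ρ : List Expr) (k : ℕ) : Pat × Expr → Option (Pat × Expr)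
  | (p, e) => do
    let e' ← e.substEnv ρ (k + p.vars.length)
    some (p, e')

end

mutual

/-- The conversion of values back to expressions. -/
def fromVal : Val → Option Expr
  | .vConstr I C args => do
    let es ← fromVals args
    some (es.foldl .eApp (.eConstr I C))
  | .vClosLam ρ x τ e => do
    let ρ' ← fromVals ρ
    (Expr.eLambda x τ e).substEnv ρ' 0
  | .vClosFix ρ f x τ₁ τ₂ e => do
    let ρ' ← fromVals ρ
    (Expr.eFix f x τ₁ τ₂ e).substEnv ρ' 0
  | .vTyClos ρ A e => do
    let ρ' ← fromVals ρ
    (Expr.eTyLam A e).substEnv ρ' 0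
  | .vTy τ => some (.eTy τ)

def fromVals : List Val → Option (List Expr)
  | [] => some []
  | v :: vs => do
    let e ← fromVal v
    let es ← fromVals vs
    some (e :: es)

end

end Acorn

/-! Terms of the Polymorphic Cumulative Calculus of Inductive Constructions, as formalised in
MetaCoq, with the weak call-by-value evaluation relation. -/

namespace MetaCoq

/-- Binder names. -/
inductive Name where
  | nAnon
  | nNamed (x : String)

/-- An inductive type: the name of a mutual block and the position in the block. -/
structure Ind where
  mind : String
  idx : ℕ

/-- Universe levels; `lVar` is a bound (polymorphic) level. -/
inductive Level where
  | lProp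
  | lSet
  | level (s : String)
  | lVar (n : ℕ)

/-- Universes: non-empty formal maxima of expressions `l` (flag `false`) and `l + 1` (flag
`true`). -/
structure Univ where
  head : Level × Bool
  tail : List (Level × Bool)

def Univ.set : Univ := ⟨(.lSet, false), []⟩

/-- One body of a block of (co)fixpoints; `rarg` is the position of the recursive argument. -/
structure Def (α : Type) where
  dname : Name
  dtype : α
  dbody : α
  rarg : ℕ

inductive Term where
  | tRel (n : ℕ)
  | tVar (x : String)
  | tEvar (n : ℕ) (l : List Term)
  | tSort (s : Univ)
  | tProd (na : Name) (A B : Term)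
  | tLambda (na : Name) (A t : Term)
  | tLetIn (na : Name) (b B t : Term)
  | tApp (u v : Term)
  | tConst (c : String) (u : List Level)
  | tInd (ind : Ind) (u : List Level)
  | tConstruct (ind : Ind) (n : ℕ) (u : List Level)
    /- `tCase ind npar p c brs`: the predicate `p` and the branches are iterated lambdas, each
    branch comes with the number of its arguments. -/
  | tCase (ind : Ind) (npar : ℕ) (p c : Term) (brs : List (ℕ × Term))
    /- `tProj ind npar arg c` -/
  | tProj (ind : Ind) (npar arg : ℕ) (c : Term)
  | tFix (mfix : List (Def Term)) (idx : ℕ)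
  | tCoFix (mfix : List (Def Term)) (idx : ℕ)

mutual

/-- Add `n` to all indices that are at least `k`. -/
def Term.lift (n k : ℕ) : Term → Term
  | .tRel i => if k ≤ i then .tRel (n + i) else .tRel i
  | .tVar x => .tVar x
  | .tEvar m l => .tEvar m (liftList n k l)
  | .tSort s => .tSort s
  | .tProd na A B => .tProd na (A.lift n k) (B.lift n (k + 1))
  | .tLambda na A t => .tLambda na (A.lift n k) (t.lift n (k + 1))
  | .tLetIn na b B t => .tLetIn na (b.lift n k) (B.lift n k) (t.lift n (k + 1))
  | .tApp u v => .tApp (u.lift n k) (v.lift n k)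
  | .tConst c u => .tConst c u
  | .tInd ind u => .tInd ind u
  | .tConstruct ind m u => .tConstruct ind m u
  | .tCase ind npar p c brs => .tCase ind npar (p.lift n k) (c.lift n k) (liftBrs n k brs)
  | .tProj ind npar arg c => .tProj ind npar arg (c.lift n k)
  | .tFix mfix idx => .tFix (liftDefs n k (k + mfix.length) mfix) idx
  | .tCoFix mfix idx => .tCoFix (liftDefs n k (k + mfix.length) mfix) idx

def liftList (n k : ℕ) : List Term → List Term
  | [] => []
  | t :: ts => t.lift n k :: liftList n k ts

def liftBrs (n k : ℕ) : List (ℕ × Term) → List (ℕ × Term)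
  | [] => []
  | b :: bs => liftBr n k b :: liftBrs n k bs

def liftBr (n k : ℕ) : ℕ × Term → ℕ × Term
  | (m, t) => (m, t.lift n k)

/-- The types of a block live in the outer context, the bodies also see the block. -/
def liftDefs (n k k' : ℕ) : List (Def Term) → List (Def Term)
  | [] => []
  | d :: ds => liftDef n k k' d :: liftDefs n k k' ds

def liftDef (n k k' : ℕ) : Def Term → Def Term
  | ⟨na, ty, b, r⟩ => ⟨na, ty.lift n k, b.lift n k', r⟩

end

mutual

/-- Parallel substitution of `s` for the indices from `k` on. -/
def Term.subst (s : List Term) (k : ℕ) : Term → Term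
  | .tRel i =>
    if k ≤ i then
      match s[i - k]? with
      | some b => b.lift k 0
      | none => .tRel (i - s.length)
    else .tRel i
  | .tVar x => .tVar x
  | .tEvar m l => .tEvar m (substList s k l)
  | .tSort u => .tSort u
  | .tProd na A B => .tProd na (A.subst s k) (B.subst s (k + 1))
  | .tLambda na A t => .tLambda na (A.subst s k) (t.subst s (k + 1))
  | .tLetIn na b B t => .tLetIn na (b.subst s k) (B.subst s k) (t.subst s (k + 1))
  | .tApp u v => .tApp (u.subst s k) (v.subst s k)
  | .tConst c u => .tConst c u
  | .tInd ind u => .tInd ind u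
  | .tConstruct ind m u => .tConstruct ind m u
  | .tCase ind npar p c brs => .tCase ind npar (p.subst s k) (c.subst s k) (substBrs s k brs)
  | .tProj ind npar arg c => .tProj ind npar arg (c.subst s k)
  | .tFix mfix idx => .tFix (substDefs s k (k + mfix.length) mfix) idx
  | .tCoFix mfix idx => .tCoFix (substDefs s k (k + mfix.length) mfix) idx

def substList (s : List Term) (k : ℕ) : List Term → List Term
  | [] => []
  | t :: ts => t.subst s k :: substList s k ts

def substBrs (s : List Term) (k : ℕ) : List (ℕ × Term) → List (ℕ × Term)
  | [] => []
  | b :: bs => substBr s k b :: substBrs s k bs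

def substBr (s : List Term) (k : ℕ) : ℕ × Term → ℕ × Term
  | (m, t) => (m, t.subst s k)

def substDefs (s : List Term) (k k' : ℕ) : List (Def Term) → List (Def Term)
  | [] => []
  | d :: ds => substDef s k k' d :: substDefs s k k' ds

def substDef (s : List Term) (k k' : ℕ) : Def Term → Def Term
  | ⟨na, ty, b, r⟩ => ⟨na, ty.subst s k, b.subst s k', r⟩

end

/-- Instantiation of the bound universe levels. -/
def Level.inst (u : List Level) : Level → Level
  | .lVar n => u.getD n .lSet
  | l => l

def Univ.inst (u : List Level) (s : Univ) : Univ :=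
  ⟨(s.head.1.inst u, s.head.2), s.tail.map fun l => (l.1.inst u, l.2)⟩

mutual

def Term.inst (u : List Level) : Term → Term
  | .tRel i => .tRel i
  | .tVar x => .tVar x
  | .tEvar m l => .tEvar m (instList u l)
  | .tSort s => .tSort (s.inst u)
  | .tProd na A B => .tProd na (A.inst u) (B.inst u)
  | .tLambda na A t => .tLambda na (A.inst u) (t.inst u)
  | .tLetIn na b B t => .tLetIn na (b.inst u) (B.inst u) (t.inst u)
  | .tApp t v => .tApp (t.inst u) (v.inst u)
  | .tConst c w => .tConst c (w.map (Level.inst u))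
  | .tInd ind w => .tInd ind (w.map (Level.inst u))
  | .tConstruct ind m w => .tConstruct ind m (w.map (Level.inst u))
  | .tCase ind npar p c brs => .tCase ind npar (p.inst u) (c.inst u) (instBrs u brs)
  | .tProj ind npar arg c => .tProj ind npar arg (c.inst u)
  | .tFix mfix idx => .tFix (instDefs u mfix) idx
  | .tCoFix mfix idx => .tCoFix (instDefs u mfix) idx

def instList (u : List Level) : List Term → List Term
  | [] => []
  | t :: ts => t.inst u :: instList u ts

def instBrs (u : List Level) : List (ℕ × Term) → List (ℕ × Term)
  | [] => []
  | b :: bs => instBr u b :: instBrs u bs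

def instBr (u : List Level) : ℕ × Term → ℕ × Term
  | (m, t) => (m, t.inst u)

def instDefs (u : List Level) : List (Def Term) → List (Def Term)
  | [] => []
  | d :: ds => instDef u d :: instDefs u ds

def instDef (u : List Level) : Def Term → Def Term
  | ⟨na, ty, b, r⟩ => ⟨na, ty.inst u, b.inst u, r⟩

end

def mkApps (t : Term) (args : List Term) : Term := args.foldl .tApp t

/-- The head of an iterated application. -/
def Term.appHead : Term → Term
  | .tApp u _ => u.appHead
  | t => t

def Term.isConstructApp (t : Term) : Prop := ∃ ind n u, t.appHead = .tConstruct ind n u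

def Term.isFixApp (t : Term) : Prop := ∃ mfix idx, t.appHead = .tFix mfix idx

def Term.isLambda (t : Term) : Prop := ∃ na A b, t = .tLambda na A b

/-- Sorts and products. -/
def Term.isArityHead (t : Term) : Prop := (∃ s, t = .tSort s) ∨ ∃ na A B, t = .tProd na A B

/-- Terms that are values on their own. -/
def Term.isAtom : Term → Prop
  | .tInd _ _ | .tConstruct _ _ _ | .tFix _ _ | .tCoFix _ _ | .tLambda _ _ _ | .tSort _
  | .tProd _ _ _ => True
  | _ => False

/-- The entry of `args` at position `n` exists and is an applied constructor. -/
def isConstructorAt (n : ℕ) (args : List Term) : Prop :=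
  ∃ a, args[n]? = some a ∧ a.isConstructApp

/-- The terms to be substituted into the bodies of a block of fixpoints; the last body of the
block is index `0`. -/
def fixSubst (mfix : List (Def Term)) : List Term :=
  ((List.range mfix.length).map (Term.tFix mfix)).reverse

def cofixSubst (mfix : List (Def Term)) : List Term :=
  ((List.range mfix.length).map (Term.tCoFix mfix)).reverse

/-- The position of the recursive argument, and the unfolded body. -/
def unfoldFix (mfix : List (Def Term)) (idx : ℕ) : Option (ℕ × Term) :=
  mfix[idx]?.map fun d => (d.rarg, d.dbody.subst (fixSubst mfix) 0)

def unfoldCofix (mfix : List (Def Term)) (idx : ℕ) : Option (ℕ × Term) :=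
  mfix[idx]?.map fun d => (d.rarg, d.dbody.subst (cofixSubst mfix) 0)

/-- A constant of the global environment of MetaCoq. -/
structure ConstDecl where
  name : String
  type : Term
  body : Option Term

/-- The constants of the global environment of MetaCoq; evaluation depends on no other
declarations. -/
abbrev ConstEnv := List ConstDecl

def lookupConst (E : ConstEnv) (c : String) : Option ConstDecl :=
  E.find? fun d => d.name == c

/-- Weak call-by-value evaluation, in the empty local context. -/
inductive Eval (E : ConstEnv) : Term → Term → Prop where
  | beta {f na A b a a' res} :
      Eval E f (.tLambda na A b) → Eval E a a' → Eval E (b.subst [a'] 0) res →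
      Eval E (.tApp f a) res
  | zeta {na b b' B t res} :
      Eval E b b' → Eval E (t.subst [b'] 0) res → Eval E (.tLetIn na b B t) res
  | delta {c u d body res} :
      lookupConst E c = some d → d.body = some body → Eval E (body.inst u) res →
      Eval E (.tConst c u) res
  | constNoBody {c u d} :
      lookupConst E c = some d → d.body = none → Eval E (.tConst c u) (.tConst c u)
  | iota {ind npar p discr i u args brs br res} :
      Eval E discr (mkApps (.tConstruct ind i u) args) → brs[i]? = some br →
      Eval E (mkApps br.2 (args.drop npar)) res → Eval E (.tCase ind npar p discr brs) res
  | proj {ind npar arg discr i u args a res} :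
      Eval E discr (mkApps (.tConstruct ind i u) args) → args[npar + arg]? = some a →
      Eval E a res → Eval E (.tProj ind npar arg discr) res
    /- Unfold a fixpoint whose recursive argument is an applied constructor. -/
  | fix {f mfix idx args a a' narg fn res} :
      Eval E f (mkApps (.tFix mfix idx) args) → Eval E a a' →
      unfoldFix mfix idx = some (narg, fn) → isConstructorAt narg (args ++ [a']) →
      Eval E (mkApps fn (args ++ [a'])) res → Eval E (.tApp f a) res
    /- Otherwise the fixpoint is stuck. -/
  | fixValue {f mfix idx args a a' narg fn} :
      Eval E f (mkApps (.tFix mfix idx) args) → Eval E a a' →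
      unfoldFix mfix idx = some (narg, fn) → ¬ isConstructorAt narg (args ++ [a']) →
      Eval E (.tApp f a) (mkApps (.tFix mfix idx) (args ++ [a']))
  | cofixCase {ind npar p mfix idx args narg fn brs res} :
      unfoldCofix mfix idx = some (narg, fn) →
      Eval E (.tCase ind npar p (mkApps fn args) brs) res →
      Eval E (.tCase ind npar p (mkApps (.tCoFix mfix idx) args) brs) res
  | cofixProj {ind npar arg mfix idx args narg fn res} :
      unfoldCofix mfix idx = some (narg, fn) →
      Eval E (.tProj ind npar arg (mkApps fn args)) res →
      Eval E (.tProj ind npar arg (mkApps (.tCoFix mfix idx) args)) res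
    /- Heads that do not produce a redex, such as constructors and inductive types. -/
  | appCong {f f' a a'} :
      Eval E f f' → ¬ (f'.isLambda ∨ f'.isFixApp ∨ f'.isArityHead) → Eval E a a' →
      Eval E (.tApp f a) (.tApp f' a')
  | atom {t} : t.isAtom → Eval E t t

end MetaCoq

/-! The translation into MetaCoq. Where a lookup fails (a name missing in the global environment,
a missing branch, a wrong number of parameters or of pattern variables), the translation contains a
named variable `tVar`, which does not evaluate. -/

namespace Acorn

open MetaCoq (Term Name Univ Ind mkApps)

def indTerm (I : String) : Term := .tInd ⟨I, 0⟩ []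

def transTy : Ty → Term
  | .tyInd I => indTerm I
  | .tyForall A τ => .tProd (.nNamed A) (.tSort Univ.set) (transTy τ)
  | .tyApp τ₁ τ₂ => .tApp (transTy τ₁) (transTy τ₂)
  | .tyRel i => .tRel i
  | .tyArr τ₁ τ₂ => .tProd .nAnon (transTy τ₁) ((transTy τ₂).lift 1 0)

/-- `fun (x₁ : σ₁{ps}) (x₂ : σ₂{↑ps}) … => t`. -/
def patLambdas : List Term → List (String × Term) → Term → Term
  | _, [], t => t
  | ps, (x, σ) :: xs, t =>
    .tLambda (.nNamed x) (σ.subst ps 0) (patLambdas (ps.map (Term.lift 1 0)) xs t)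

/-- The branch for the constructor `c`. The parameters are reversed because index `0` in the
argument types is the last parameter. -/
def transBranch (params : List Ty) (bs : List (Pat × Term)) (c : Ctor) : ℕ × Term :=
  match bs.find? fun b => b.1.ctor == c.name with
  | none => (0, .tVar c.name)
  | some (p, t) =>
    if p.vars.length = c.args.length then
      (p.vars.length,
        patLambdas (params.map transTy).reverse (p.vars.zip (c.args.map transTy)) t)
    else (0, .tVar c.name)

mutual

def trans (G : GlobalEnv) : Expr → Term
  | .eRel i => .tRel i
  | .eLambda x τ e => .tLambda (.nNamed x) (transTy τ) (trans G e)
  | .eTyLam A e => .tLambda (.nNamed A) (.tSort Univ.set) (trans G e)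
  | .eLetIn x τ e₁ e₂ => .tLetIn (.nNamed x) (trans G e₁) (transTy τ) (trans G e₂)
  | .eApp e₁ e₂ => .tApp (trans G e₁) (trans G e₂)
  | .eCase e I params σ bs =>
    match resolveInd G I with
    | none => .tVar I
    | some d =>
      if params.length = d.nparams then
        .tCase ⟨I, 0⟩ d.nparams
          (.tLambda .nAnon (mkApps (indTerm I) (params.map transTy)) ((transTy σ).lift 1 0))
          (trans G e) (d.ctors.map (transBranch params (transBodies G bs)))
      else .tVar I
  | .eConstr I C =>
    match resolveConstr G I C with
    | none => .tVar C
    | some (_, i, _) => .tConstruct ⟨I, 0⟩ i []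
  | .eFix f x τ₁ τ₂ e =>
    .tFix [{ dname := .nNamed f
             dtype := .tProd .nAnon (transTy τ₁) ((transTy τ₂).lift 1 0)
             dbody := .tLambda (.nNamed x) ((transTy τ₁).lift 1 0) (trans G e)
             rarg := 0 }] 0
  | .eTy τ => transTy τ

def transBodies (G : GlobalEnv) : List (Pat × Expr) → List (Pat × Term)
  | [] => []
  | b :: bs => transBody G b :: transBodies G bs

def transBody (G : GlobalEnv) : Pat × Expr → Pat × Term
  | (p, e) => (p, trans G e)

end

end Acorn

namespace MetaCoq

theorem liftBrs_eq_map (n k : ℕ) (brs : List (ℕ × Term)) :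
    liftBrs n k brs = brs.map fun b => (b.1, b.2.lift n k) := by
  induction brs with
  | nil => rfl
  | cons b bs ih => cases b; simp [liftBrs, liftBr, ih]

theorem substBrs_eq_map (s : List Term) (k : ℕ) (brs : List (ℕ × Term)) :
    substBrs s k brs = brs.map fun b => (b.1, b.2.subst s k) := by
  induction brs with
  | nil => rfl
  | cons b bs ih => cases b; simp [substBrs, substBr, ih]

/-- The terms in the image of the translation whose free indices are all below `k`. -/
inductive Term.Scoped : ℕ → Term → Prop
  | tRel {k i} : i < k → Scoped k (.tRel i)
  | tVar {k x} : Scoped k (.tVar x)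
  | tSort {k s} : Scoped k (.tSort s)
  | tProd {k na A B} : Scoped k A → Scoped (k + 1) B → Scoped k (.tProd na A B)
  | tLambda {k na A t} : Scoped k A → Scoped (k + 1) t → Scoped k (.tLambda na A t)
  | tLetIn {k na b B t} : Scoped k b → Scoped k B → Scoped (k + 1) t →
      Scoped k (.tLetIn na b B t)
  | tApp {k u v} : Scoped k u → Scoped k v → Scoped k (.tApp u v)
  | tInd {k ind u} : Scoped k (.tInd ind u)
  | tConstruct {k ind n u} : Scoped k (.tConstruct ind n u)
  | tCase {k ind npar p c brs} : Scoped k p → Scoped k c → (∀ b ∈ brs, Scoped k b.2) →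
      Scoped k (.tCase ind npar p c brs)
  | tFix {k na A t r} : Scoped k A → Scoped (k + 1) t → Scoped k (.tFix [⟨na, A, t, r⟩] 0)

namespace Term

theorem Scoped.lift_eq {k : ℕ} {t : Term} (h : t.Scoped k) (n : ℕ) {j : ℕ} (hj : k ≤ j) :
    t.lift n j = t := by
  induction h generalizing j with
  | tRel hi => simp [Term.lift]; omega
  | tCase _ _ _ ihp ihc ihb =>
    simp only [Term.lift, ihp hj, ihc hj, liftBrs_eq_map, tCase.injEq, true_and]
    refine (List.map_congr_left fun b hb => ?_).trans (List.map_id _)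
    simp [ihb b hb hj]
  | _ => simp_all [Term.lift, liftDefs, liftDef]

theorem Scoped.subst_eq {k : ℕ} {t : Term} (h : t.Scoped k) (s : List Term) {j : ℕ}
    (hj : k ≤ j) : t.subst s j = t := by
  induction h generalizing j with
  | tRel hi => rw [Term.subst, if_neg (by omega)]
  | tCase _ _ _ ihp ihc ihb =>
    simp only [Term.subst, ihp hj, ihc hj, substBrs_eq_map, tCase.injEq, true_and]
    refine (List.map_congr_left fun b hb => ?_).trans (List.map_id _)
    simp [ihb b hb hj]
  | _ => simp_all [Term.subst, substDefs, substDef]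

theorem Scoped.mono {k m : ℕ} {t : Term} (h : t.Scoped k) (hm : k ≤ m) : t.Scoped m := by
  induction h generalizing m with
  | tRel hi => exact .tRel (by omega)
  | tVar => exact .tVar
  | tSort => exact .tSort
  | tProd _ _ ih₁ ih₂ => exact .tProd (ih₁ hm) (ih₂ (by omega))
  | tLambda _ _ ih₁ ih₂ => exact .tLambda (ih₁ hm) (ih₂ (by omega))
  | tLetIn _ _ _ ih₁ ih₂ ih₃ => exact .tLetIn (ih₁ hm) (ih₂ hm) (ih₃ (by omega))
  | tApp _ _ ih₁ ih₂ => exact .tApp (ih₁ hm) (ih₂ hm)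
  | tInd => exact .tInd
  | tConstruct => exact .tConstruct
  | tCase _ _ _ ihp ihc ihb => exact .tCase (ihp hm) (ihc hm) fun b hb => ihb b hb hm
  | tFix _ _ ih₁ ih₂ => exact .tFix (ih₁ hm) (ih₂ (by omega))

theorem Scoped.lift {k : ℕ} {t : Term} (h : t.Scoped k) (n j : ℕ) :
    (t.lift n j).Scoped (k + n) := by
  induction h generalizing j with
  | tRel hi =>
    rw [Term.lift]
    split <;> exact .tRel (by omega)
  | tVar => exact .tVar
  | tSort => exact .tSort
  | tProd _ _ ih₁ ih₂ => exact .tProd (ih₁ _) ((ih₂ _).mono (by omega))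
  | tLambda _ _ ih₁ ih₂ => exact .tLambda (ih₁ _) ((ih₂ _).mono (by omega))
  | tLetIn _ _ _ ih₁ ih₂ ih₃ => exact .tLetIn (ih₁ _) (ih₂ _) ((ih₃ _).mono (by omega))
  | tApp _ _ ih₁ ih₂ => exact .tApp (ih₁ _) (ih₂ _)
  | tInd => exact .tInd
  | tConstruct => exact .tConstruct
  | tCase _ _ _ ihp ihc ihb =>
    refine .tCase (ihp _) (ihc _) ?_
    rw [liftBrs_eq_map, List.forall_mem_map]
    exact fun b hb => ihb b hb _
  | tFix _ _ ih₁ ih₂ => exact .tFix (ih₁ _) ((ih₂ _).mono (by omega))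

theorem Scoped.subst {l : ℕ} {t : Term} (h : t.Scoped l) {s : List Term} {k m : ℕ}
    (hl : l ≤ s.length + k) (hs : ∀ b ∈ s, b.Scoped m) : (t.subst s k).Scoped (m + k) := by
  induction h generalizing k with
  | @tRel l i hi =>
    rw [Term.subst]
    split
    · have hlt : i - k < s.length := by omega
      rw [List.getElem?_eq_getElem hlt]
      exact (hs _ (List.getElem_mem hlt)).lift _ _
    · exact .tRel (by omega)
  | tVar => exact .tVar
  | tSort => exact .tSort
  | tProd _ _ ih₁ ih₂ => exact .tProd (ih₁ hl) (ih₂ (k := k + 1) (by omega))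
  | tLambda _ _ ih₁ ih₂ => exact .tLambda (ih₁ hl) (ih₂ (k := k + 1) (by omega))
  | tLetIn _ _ _ ih₁ ih₂ ih₃ => exact .tLetIn (ih₁ hl) (ih₂ hl) (ih₃ (k := k + 1) (by omega))
  | tApp _ _ ih₁ ih₂ => exact .tApp (ih₁ hl) (ih₂ hl)
  | tInd => exact .tInd
  | tConstruct => exact .tConstruct
  | tCase _ _ _ ihp ihc ihb =>
    refine .tCase (ihp hl) (ihc hl) ?_
    rw [substBrs_eq_map, List.forall_mem_map]
    exact fun b hb => ihb b hb hl
  | tFix _ _ ih₁ ih₂ => exact .tFix (ih₁ hl) (ih₂ (k := k + 1) (by omega))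

/-- Lifting commutes with the substitution of closed terms. -/
theorem Scoped.subst_lift {l : ℕ} {t : Term} (h : t.Scoped l) {s : List Term}
    (hs : ∀ b ∈ s, b.Scoped 0) (n : ℕ) {j k : ℕ} (hj : j ≤ k) :
    (t.lift n j).subst s (k + n) = (t.subst s k).lift n j := by
  induction h generalizing j k with
  | @tRel l i hi =>
    by_cases hki : k ≤ i
    · rw [Term.lift, if_pos (by omega), Term.subst, Term.subst, if_pos (by omega), if_pos hki,
        show n + i - (k + n) = i - k by omega]
      cases hb : s[i - k]? with
      | none =>
        have := List.getElem?_eq_none_iff.1 hb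
        simp only
        rw [Term.lift, if_pos (by omega), show n + i - s.length = n + (i - s.length) by omega]
      | some b =>
        have hb0 := hs b (List.mem_of_getElem? hb)
        simp only
        rw [hb0.lift_eq _ (Nat.zero_le _), hb0.lift_eq _ (Nat.zero_le _),
          hb0.lift_eq _ (Nat.zero_le _)]
    · rw [Term.subst, if_neg hki, Term.lift]
      split
      · rw [Term.subst, if_neg (by omega)]
      · rw [Term.subst, if_neg (by omega)]
  | tVar | tSort | tInd | tConstruct => rfl
  | tProd _ _ ih₁ ih₂ | tLambda _ _ ih₁ ih₂ =>
    simp only [Term.lift, Term.subst, ih₁ hj, Nat.add_right_comm k n 1,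
      ih₂ (Nat.succ_le_succ hj)]
  | tLetIn _ _ _ ih₁ ih₂ ih₃ =>
    simp only [Term.lift, Term.subst, ih₁ hj, ih₂ hj, Nat.add_right_comm k n 1,
      ih₃ (Nat.succ_le_succ hj)]
  | tApp _ _ ih₁ ih₂ => simp only [Term.lift, Term.subst, ih₁ hj, ih₂ hj]
  | tCase _ _ _ ihp ihc ihb =>
    simp only [Term.lift, Term.subst, ihp hj, ihc hj, liftBrs_eq_map, substBrs_eq_map,
      List.map_map, tCase.injEq, true_and]
    exact List.map_congr_left fun b hb => by simp [ihb b hb hj]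
  | tFix _ _ ih₁ ih₂ =>
    simp only [Term.lift, Term.subst, liftDefs, liftDef, substDefs, substDef, ih₁ hj,
      List.length_singleton, Nat.add_right_comm k n 1, ih₂ (Nat.succ_le_succ hj)]

/-- The substitution of closed terms commutes with the substitution for all variables. -/
theorem Scoped.subst_subst {l : ℕ} {t : Term} (h : t.Scoped l) {s ps : List Term} {m : ℕ}
    (hs : ∀ b ∈ s, b.Scoped 0) (hps : ∀ b ∈ ps, b.Scoped m) {j k : ℕ} (hl : l ≤ ps.length + j) :
    (t.subst ps j).subst s (k + j) = t.subst (ps.map (Term.subst s k)) j := by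
  induction h generalizing j with
  | @tRel l i hi =>
    by_cases hji : j ≤ i
    · have hlt : i - j < ps.length := by omega
      rw [Term.subst, Term.subst, if_pos hji, if_pos hji, List.getElem?_map,
        List.getElem?_eq_getElem hlt]
      exact (hps _ (List.getElem_mem hlt)).subst_lift hs _ (Nat.zero_le _)
    · rw [Term.subst, Term.subst, if_neg hji, if_neg hji, Term.subst, if_neg (by omega)]
  | tVar | tSort | tInd | tConstruct => rfl
  | tProd _ _ ih₁ ih₂ | tLambda _ _ ih₁ ih₂ =>
    simp only [Term.subst, ih₁ hl, Nat.add_assoc k j 1, ih₂ (j := j + 1) (Nat.succ_le_succ hl)]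
  | tLetIn _ _ _ ih₁ ih₂ ih₃ =>
    simp only [Term.subst, ih₁ hl, ih₂ hl, Nat.add_assoc k j 1, ih₃ (j := j + 1) (Nat.succ_le_succ hl)]
  | tApp _ _ ih₁ ih₂ => simp only [Term.subst, ih₁ hl, ih₂ hl]
  | tCase _ _ _ ihp ihc ihb =>
    simp only [Term.subst, ihp hl, ihc hl, substBrs_eq_map, List.map_map, tCase.injEq, true_and]
    exact List.map_congr_left fun b hb => by simp [ihb b hb hl]
  | tFix _ _ ih₁ ih₂ =>
    simp only [Term.subst, substDefs, substDef, ih₁ hl, List.length_singleton,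
      Nat.add_assoc k j 1, ih₂ (j := j + 1) (Nat.succ_le_succ hl)]

/-- Two successive substitutions of closed terms are one parallel substitution. -/
theorem Scoped.subst_append {l : ℕ} {t : Term} (h : t.Scoped l) {a s : List Term}
    (hs : ∀ b ∈ s, b.Scoped 0) {j k : ℕ} (hj : j = k + a.length) :
    (t.subst s j).subst a k = t.subst (a ++ s) k := by
  induction h generalizing j k with
  | @tRel l i hi =>
    rw [Term.subst, Term.subst]
    by_cases hji : j ≤ i
    · rw [if_pos hji, if_pos (by omega), List.getElem?_append_right (by omega),
        show i - k - a.length = i - j by omega]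
      cases hb : s[i - j]? with
      | none =>
        have := List.getElem?_eq_none_iff.1 hb
        simp only
        rw [Term.subst, if_pos (by omega), List.getElem?_eq_none (by omega)]
        simp only [List.length_append]
        congr 1
        omega
      | some b =>
        have hb0 := hs b (List.mem_of_getElem? hb)
        simp only
        rw [hb0.lift_eq _ (Nat.zero_le _), hb0.lift_eq _ (Nat.zero_le _),
          hb0.subst_eq _ (Nat.zero_le _)]
    · rw [if_neg hji, Term.subst]
      by_cases hki : k ≤ i
      · have hlt : i - k < a.length := by omega
        rw [if_pos hki, if_pos hki, List.getElem?_append_left hlt,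
          List.getElem?_eq_getElem hlt]
      · rw [if_neg hki, if_neg hki]
  | tVar | tSort | tInd | tConstruct => rfl
  | tProd _ _ ih₁ ih₂ | tLambda _ _ ih₁ ih₂ =>
    simp only [Term.subst, ih₁ hj, ih₂ (show j + 1 = k + 1 + a.length by omega)]
  | tLetIn _ _ _ ih₁ ih₂ ih₃ =>
    simp only [Term.subst, ih₁ hj, ih₂ hj, ih₃ (show j + 1 = k + 1 + a.length by omega)]
  | tApp _ _ ih₁ ih₂ => simp only [Term.subst, ih₁ hj, ih₂ hj]
  | tCase _ _ _ ihp ihc ihb =>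
    simp only [Term.subst, ihp hj, ihc hj, substBrs_eq_map, List.map_map, tCase.injEq, true_and]
    exact List.map_congr_left fun b hb => by simp [ihb b hb hj]
  | tFix _ _ ih₁ ih₂ =>
    simp only [Term.subst, substDefs, substDef, ih₁ hj, List.length_singleton,
      ih₂ (show j + 1 = k + 1 + a.length by omega)]

end Term

theorem subst_mkApps (f : Term) (l s : List Term) (k : ℕ) :
    (mkApps f l).subst s k = mkApps (f.subst s k) (l.map (Term.subst s k)) := by
  induction l generalizing f with
  | nil => rfl
  | cons a l ih => exact ih _

theorem scoped_mkApps {f : Term} {l : List Term} {k : ℕ} (hf : f.Scoped k)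
    (hl : ∀ a ∈ l, a.Scoped k) : (mkApps f l).Scoped k := by
  induction l generalizing f with
  | nil => exact hf
  | cons a l ih =>
    rw [List.forall_mem_cons] at hl
    exact ih (.tApp hf hl.1) hl.2

theorem mkApps_concat (f : Term) (l : List Term) (a : Term) :
    mkApps f (l ++ [a]) = .tApp (mkApps f l) a := by
  simp [mkApps]

theorem appHead_mkApps (f : Term) (l : List Term) : (mkApps f l).appHead = f.appHead := by
  induction l generalizing f with
  | nil => rfl
  | cons a l ih => exact ih _

theorem fixSubst_singleton (d : Def Term) : fixSubst [d] = [.tFix [d] 0] := rfl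

/-- The term is `t` under `n` abstractions. -/
inductive IsLambdas : ℕ → Term → Term → Prop
  | zero {t} : IsLambdas 0 t t
  | succ {n na A b t} : IsLambdas n b t → IsLambdas (n + 1) (.tLambda na A b) t

theorem IsLambdas.subst {n : ℕ} {b t : Term} (h : IsLambdas n b t) (s : List Term) (k : ℕ) :
    IsLambdas n (b.subst s k) (t.subst s (k + n)) := by
  induction h generalizing k with
  | zero => exact .zero
  | @succ n _ _ _ _ _ ih =>
    rw [show k + (n + 1) = k + 1 + n by omega]
    exact .succ (ih _)

theorem not_redex_of_appHead {f : Term}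
    (h : (∃ ind u, f.appHead = .tInd ind u) ∨ ∃ ind n u, f.appHead = .tConstruct ind n u) :
    ¬ (f.isLambda ∨ f.isFixApp ∨ f.isArityHead) := by
  rintro (⟨_, _, _, rfl⟩ | ⟨_, _, h'⟩ | ⟨_, rfl⟩ | ⟨_, _, _, rfl⟩) <;>
    simp_all [Term.appHead]

/-- Application of iterated abstractions to values. -/
theorem Eval.mkApps_lambdas {E : ConstEnv} {n : ℕ} {args : List Term} {f b t res : Term}
    (hb : IsLambdas (n + 1) b t) (hf : Eval E f b) (hn : args.length = n + 1)
    (ht : t.Scoped (n + 1)) (hargs : ∀ a ∈ args, Eval E a a) (hc : ∀ a ∈ args, a.Scoped 0)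
    (hres : Eval E (t.subst args.reverse 0) res) : Eval E (mkApps f args) res := by
  induction n generalizing args f b t with
  | zero =>
    obtain ⟨a, rfl⟩ := List.length_eq_one_iff.1 hn
    obtain _ | @⟨_, _, _, b, _, hb⟩ := hb
    cases hb
    exact .beta hf (hargs a (by simp)) hres
  | succ n ih =>
    obtain _ | ⟨a, args⟩ := args
    · simp at hn
    rw [List.forall_mem_cons] at hargs hc
    obtain _ | @⟨_, _, _, b, _, hb⟩ := hb
    have hb' := hb.subst [a] 0
    have hlam : Eval E (b.subst [a] 0) (b.subst [a] 0) := by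
      cases hb with
      | succ => exact .atom trivial
    refine ih (args := args) (f := .tApp f a) hb' (.beta hf hargs.1 hlam) (by simpa using hn)
      ((ht.subst (m := 0) (by simp) (by simpa using hc.1)).mono (by omega))
      hargs.2 hc.2 ?_
    rw [ht.subst_append (by simpa using hc.1) (by simpa using hn.symm)]
    simpa using hres

end MetaCoq

namespace Acorn

open MetaCoq (Term Name Univ Ind mkApps IsLambdas)

theorem Expr.induct {P : Expr → Prop} (eRel : ∀ i, P (.eRel i))
    (eLambda : ∀ x τ e, P e → P (.eLambda x τ e)) (eTyLam : ∀ A e, P e → P (.eTyLam A e))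
    (eLetIn : ∀ x τ e₁ e₂, P e₁ → P e₂ → P (.eLetIn x τ e₁ e₂))
    (eApp : ∀ e₁ e₂, P e₁ → P e₂ → P (.eApp e₁ e₂))
    (eCase : ∀ e I params σ bs, P e → (∀ b ∈ bs, P b.2) → P (.eCase e I params σ bs))
    (eConstr : ∀ I C, P (.eConstr I C))
    (eFix : ∀ f x τ₁ τ₂ e, P e → P (.eFix f x τ₁ τ₂ e)) (eTy : ∀ τ, P (.eTy τ)) (e : Expr) :
    P e :=
  Expr.rec (motive_1 := P) (motive_2 := fun bs => ∀ b ∈ bs, P b.2) (motive_3 := fun b => P b.2)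
    eRel eLambda eTyLam eLetIn eApp eCase eConstr eFix eTy (by simp)
    (fun _ _ h hs => List.forall_mem_cons.2 ⟨h, hs⟩) (fun _ _ h => h) e

theorem branchesClosedAt_iff {n : ℕ} {bs : List (Pat × Expr)} :
    branchesClosedAt n bs = true ↔ ∀ b ∈ bs, b.2.closedAt (n + b.1.vars.length) = true := by
  induction bs with
  | nil => simp [branchesClosedAt]
  | cons b bs ih => cases b; simp [branchesClosedAt, branchClosedAt, ih]

theorem transBodies_eq_map (G : GlobalEnv) (bs : List (Pat × Expr)) :
    transBodies G bs = bs.map fun b => (b.1, trans G b.2) := by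
  induction bs with
  | nil => rfl
  | cons b bs ih => cases b; simp [transBodies, transBody, ih]

/-! Scopes of translated terms. -/

theorem scoped_transTy {τ : Ty} {n : ℕ} (h : τ.closedAt n = true) : (transTy τ).Scoped n := by
  induction τ generalizing n with
  | tyInd I => exact .tInd
  | tyForall A τ ih => exact .tProd .tSort (ih h)
  | tyApp τ₁ τ₂ ih₁ ih₂ =>
    rw [Ty.closedAt, Bool.and_eq_true] at h
    exact .tApp (ih₁ h.1) (ih₂ h.2)
  | tyRel i => exact .tRel (by simpa [Ty.closedAt] using h)
  | tyArr τ₁ τ₂ ih₁ ih₂ =>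
    rw [Ty.closedAt, Bool.and_eq_true] at h
    exact .tProd (ih₁ h.1) ((ih₂ h.2).lift 1 0)

theorem scoped_patLambdas {ps : List Term} {xs : List (String × Term)} {t : Term} {m : ℕ}
    (hps : ∀ p ∈ ps, p.Scoped m) (hxs : ∀ x ∈ xs, x.2.Scoped ps.length)
    (ht : t.Scoped (m + xs.length)) : (patLambdas ps xs t).Scoped m := by
  induction xs generalizing ps m with
  | nil => exact ht
  | cons x xs ih =>
    obtain ⟨x, σ⟩ := x
    rw [List.forall_mem_cons] at hxs
    refine .tLambda (hxs.1.subst (k := 0) le_rfl hps) (ih ?_ ?_ ?_)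
    · rw [List.forall_mem_map]
      exact fun p hp => (hps p hp).lift 1 0
    · simpa using hxs.2
    · exact ht.mono (by simp; omega)

theorem isLambdas_patLambdas (ps : List Term) (xs : List (String × Term)) (t : Term) :
    IsLambdas xs.length (patLambdas ps xs t) t := by
  induction xs generalizing ps with
  | nil => exact .zero
  | cons x xs ih => exact .succ (ih _)

theorem subst_patLambdas {ps : List Term} {xs : List (String × Term)} {t : Term} {s : List Term}
    {m k : ℕ} (hs : ∀ b ∈ s, b.Scoped 0) (hps : ∀ p ∈ ps, p.Scoped m)
    (hxs : ∀ x ∈ xs, x.2.Scoped ps.length) :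
    (patLambdas ps xs t).subst s k =
      patLambdas (ps.map (Term.subst s k)) xs (t.subst s (k + xs.length)) := by
  induction xs generalizing ps m k with
  | nil => rfl
  | cons x xs ih =>
    obtain ⟨x, σ⟩ := x
    rw [List.forall_mem_cons] at hxs
    have hσ := hxs.1.subst_subst (j := 0) (k := k) hs hps le_rfl
    rw [Nat.add_zero] at hσ
    rw [patLambdas, patLambdas, Term.subst, hσ, ih (m := m + 1), List.map_map, List.map_map, List.length_cons,
      show k + 1 + xs.length = k + (xs.length + 1) by omega]
    · congr 2
      refine List.map_congr_left fun p hp => ?_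
      exact (hps p hp).subst_lift hs 1 (Nat.zero_le _)
    · rw [List.forall_mem_map]
      exact fun p hp => (hps p hp).lift 1 0
    · simpa using hxs.2

theorem GlobalEnv.WellFormed.scoped_args {G : GlobalEnv} (hG : G.WellFormed) {d : IndDecl}
    (hd : d ∈ G) {c : Ctor} (hc : c ∈ d.ctors) {l : List String} :
    ∀ x ∈ l.zip (c.args.map transTy), x.2.Scoped d.nparams := by
  rintro ⟨x, t⟩ hx
  obtain ⟨σ, hσ, rfl⟩ := List.mem_map.1 (List.of_mem_zip hx).2
  exact scoped_transTy (hG d hd c hc σ hσ)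

theorem mem_of_resolveInd {G : GlobalEnv} {I : String} {d : IndDecl}
    (h : resolveInd G I = some d) : d ∈ G :=
  List.mem_of_find?_eq_some h

theorem scoped_trans {G : GlobalEnv} (hG : G.WellFormed) {e : Expr} {n : ℕ}
    (h : e.closedAt n = true) : (trans G e).Scoped n := by
  induction e using Expr.induct generalizing n with
  | eRel i => exact .tRel (by simpa [Expr.closedAt] using h)
  | eLambda x τ e ih =>
    rw [Expr.closedAt, Bool.and_eq_true] at h
    exact .tLambda (scoped_transTy h.1) (ih h.2)
  | eTyLam A e ih => exact .tLambda .tSort (ih h)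
  | eLetIn x τ e₁ e₂ ih₁ ih₂ =>
    simp only [Expr.closedAt, Bool.and_eq_true] at h
    exact .tLetIn (ih₁ h.1.2) (scoped_transTy h.1.1) (ih₂ h.2)
  | eApp e₁ e₂ ih₁ ih₂ =>
    rw [Expr.closedAt, Bool.and_eq_true] at h
    exact .tApp (ih₁ h.1) (ih₂ h.2)
  | eCase e I params σ bs ih ihb =>
    simp only [Expr.closedAt, Bool.and_eq_true, List.all_eq_true, branchesClosedAt_iff] at h
    obtain ⟨⟨⟨he, hp⟩, hσ⟩, hb⟩ := h
    have hp' : ∀ p ∈ params.map transTy, p.Scoped n := by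
      rw [List.forall_mem_map]
      exact fun p hmem => scoped_transTy (hp p hmem)
    rw [trans]
    split
    · exact .tVar
    · next d hd =>
      split_ifs with hlen
      · refine .tCase (.tLambda (MetaCoq.scoped_mkApps .tInd hp') ((scoped_transTy hσ).lift 1 0))
          (ih he) ?_
        rw [List.forall_mem_map]
        intro c hc
        rw [transBranch, transBodies_eq_map]
        split
        · exact .tVar
        · next p t hpt =>
          obtain ⟨b, hbm, heq⟩ := List.mem_map.1 (List.mem_of_find?_eq_some hpt)
          obtain ⟨rfl, rfl⟩ := Prod.mk.inj heq
          split_ifs with hl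
          · refine scoped_patLambdas (by simpa using hp') ?_ ?_
            · simpa [hlen] using hG.scoped_args (mem_of_resolveInd hd) hc
            · simpa [hl] using ihb b hbm (hb b hbm)
          · exact .tVar
      · exact .tVar
  | eConstr I C =>
    rw [trans]
    split
    · exact .tVar
    · exact .tConstruct
  | eFix f x τ₁ τ₂ e ih =>
    simp only [Expr.closedAt, Bool.and_eq_true] at h
    exact .tFix (.tProd (scoped_transTy h.1.1) ((scoped_transTy h.1.2).lift 1 0))
      (.tLambda ((scoped_transTy h.1.1).lift 1 0) (ih h.2))
  | eTy τ => exact scoped_transTy h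

/-! The translation of substituted expressions. -/

theorem mapM_eq_some_map {α β : Type} {f : α → Option β} {P : α → β → Prop} {l : List α}
    (h : ∀ a ∈ l, ∃ b, f a = some b ∧ P a b) :
    ∃ l', l.mapM f = some l' ∧ List.Forall₂ P l l' := by
  induction l with
  | nil => exact ⟨[], rfl, .nil⟩
  | cons a l ih =>
    rw [List.forall_mem_cons] at h
    obtain ⟨b, hb, hab⟩ := h.1
    obtain ⟨l', hl, hl'⟩ := ih h.2
    exact ⟨b :: l', by simp [List.mapM_cons, hb, hl], .cons hab hl'⟩

/-- `ρ'` is the read-back of the environment `ρ`. -/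
def ReadBack (ρ : List Val) (ρ' : List Expr) : Prop :=
  List.Forall₂ (fun v e => fromVal v = some e) ρ ρ'

theorem ReadBack.getElem?_ty {ρ : List Val} {ρ' : List Expr} (h : ReadBack ρ ρ') {i : ℕ} {τ : Ty}
    (hi : ρ[i]? = some (.vTy τ)) : ρ'[i]? = some (.eTy τ) := by
  induction h generalizing i with
  | nil => simp at hi
  | cons hv _ ih =>
    cases i with
    | zero =>
      simp only [List.getElem?_cons_zero, Option.some.injEq] at hi
      subst hi
      simpa [fromVal] using hv.symm
    | succ i => exact ih (by simpa using hi)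

theorem Ty.exists_substEnv {G : GlobalEnv} {ρ : List Val} {ρ' : List Expr} (hρ : ReadBack ρ ρ')
    {s : List Term} (hs : s = ρ'.map (trans G)) (hc : ∀ t ∈ s, t.Scoped 0) {τ : Ty} {k n : ℕ}
    (hv : τ.validIn ρ k = true) (hn : τ.closedAt n = true) :
    ∃ τ', τ.substEnv ρ' k = some τ' ∧ transTy τ' = (transTy τ).subst s k := by
  induction τ generalizing k n with
  | tyInd I => exact ⟨_, rfl, rfl⟩
  | tyForall A τ ih =>
    obtain ⟨τ', h, h'⟩ := ih (k := k + 1) hv hn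
    exact ⟨.tyForall A τ', by simp [Ty.substEnv, h], by simp [transTy, Term.subst, h']⟩
  | tyApp τ₁ τ₂ ih₁ ih₂ =>
    rw [Ty.closedAt, Bool.and_eq_true] at hn
    rw [Ty.validIn, Bool.and_eq_true] at hv
    obtain ⟨τ₁', h₁, h₁'⟩ := ih₁ hv.1 hn.1
    obtain ⟨τ₂', h₂, h₂'⟩ := ih₂ hv.2 hn.2
    exact ⟨.tyApp τ₁' τ₂', by simp [Ty.substEnv, h₁, h₂], by simp [transTy, Term.subst, h₁', h₂']⟩
  | tyRel i =>
    rw [Ty.validIn] at hv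
    by_cases hki : k ≤ i
    · rw [if_pos hki] at hv
      rw [Ty.substEnv, transTy, Term.subst, if_pos hki, if_pos hki, hs]
      split at hv
      · next hnone =>
        have hnone' : ρ'[i - k]? = none := by
          rw [List.getElem?_eq_none_iff] at hnone ⊢
          rwa [← hρ.length_eq]
        simp [hnone', transTy]
      · next τ hτ =>
        have hτ' := hρ.getElem?_ty hτ
        have hsc : (transTy τ).Scoped 0 := by
          refine hc _ ?_
          rw [hs]
          exact List.mem_map.2 ⟨_, List.mem_of_getElem? hτ', rfl⟩
        refine ⟨τ, by simp [hτ'], ?_⟩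
        simp [hτ', trans, hsc.lift_eq]
      · simp at hv
    · exact ⟨.tyRel i, by simp [Ty.substEnv, hki], by simp [transTy, Term.subst, hki]⟩
  | tyArr τ₁ τ₂ ih₁ ih₂ =>
    rw [Ty.closedAt, Bool.and_eq_true] at hn
    rw [Ty.validIn, Bool.and_eq_true] at hv
    obtain ⟨τ₁', h₁, h₁'⟩ := ih₁ hv.1 hn.1
    obtain ⟨τ₂', h₂, h₂'⟩ := ih₂ hv.2 hn.2
    refine ⟨.tyArr τ₁' τ₂', by simp [Ty.substEnv, h₁, h₂], ?_⟩
    simp [transTy, Term.subst, h₁', h₂', (scoped_transTy hn.2).subst_lift hc 1 (Nat.zero_le k)]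

theorem branchesValidIn_iff {ρ : List Val} {k : ℕ} {bs : List (Pat × Expr)} :
    branchesValidIn ρ k bs = true ↔ ∀ b ∈ bs, b.2.validIn ρ (k + b.1.vars.length) = true := by
  induction bs with
  | nil => simp [branchesValidIn]
  | cons b bs ih => cases b; simp [branchesValidIn, branchValidIn, ih]

theorem exists_substEnvBranches {G : GlobalEnv} {ρ' : List Expr} {s : List Term} {k : ℕ}
    {bs : List (Pat × Expr)}
    (h : ∀ b ∈ bs, ∃ e', b.2.substEnv ρ' (k + b.1.vars.length) = some e' ∧
      trans G e' = (trans G b.2).subst s (k + b.1.vars.length)) :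
    ∃ bs', substEnvBranches ρ' k bs = some bs' ∧
      transBodies G bs' =
        (transBodies G bs).map fun b => (b.1, b.2.subst s (k + b.1.vars.length)) := by
  induction bs with
  | nil => exact ⟨[], rfl, rfl⟩
  | cons b bs ih =>
    obtain ⟨p, e⟩ := b
    rw [List.forall_mem_cons] at h
    obtain ⟨e', he, he'⟩ := h.1
    obtain ⟨bs', hbs, hbs'⟩ := ih h.2
    refine ⟨(p, e') :: bs', ?_, ?_⟩
    · simp only at he
      simp [substEnvBranches, substEnvBranch, he, hbs]
    · simp [transBodies, transBody, he', hbs']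

theorem subst_transBranch {params params' : List Ty} {bs : List (Pat × Term)} {c : Ctor}
    {s : List Term} {k n : ℕ} (hc : ∀ t ∈ s, t.Scoped 0) (hn : ∀ p ∈ params, p.closedAt n = true)
    (hargs : ∀ l : List String, ∀ x ∈ l.zip (c.args.map transTy), x.2.Scoped params.length)
    (hp : params'.map transTy = (params.map transTy).map (Term.subst s k)) :
    transBranch params' (bs.map fun b => (b.1, b.2.subst s (k + b.1.vars.length))) c =
      ((transBranch params bs c).1, (transBranch params bs c).2.subst s k) := by
  rw [transBranch, transBranch, List.find?_map]
  have : ((fun b : Pat × Term => b.1.ctor == c.name) ∘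
      fun b : Pat × Term => (b.1, b.2.subst s (k + b.1.vars.length))) =
      fun b => b.1.ctor == c.name := rfl
  rw [this]
  cases bs.find? fun b => b.1.ctor == c.name with
  | none => rfl
  | some b =>
    obtain ⟨p, t⟩ := b
    simp only [Option.map_some]
    split_ifs with hl
    · rw [hp, ← List.map_reverse, subst_patLambdas (m := n) hc]
      · simp [hl]
      · simp only [List.mem_reverse, List.forall_mem_map]
        exact fun p hmem => scoped_transTy (hn p hmem)
      · simpa using hargs _
    · rfl

theorem Expr.exists_substEnv {G : GlobalEnv} (hG : G.WellFormed) {ρ : List Val} {ρ' : List Expr}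
    (hρ : ReadBack ρ ρ') {s : List Term} (hs : s = ρ'.map (trans G)) (hc : ∀ t ∈ s, t.Scoped 0)
    {e : Expr} {k n : ℕ} (hv : e.validIn ρ k = true) (hn : e.closedAt n = true) :
    ∃ e', e.substEnv ρ' k = some e' ∧ trans G e' = (trans G e).subst s k := by
  induction e using Expr.induct generalizing k n with
  | eRel i =>
    by_cases hki : k ≤ i
    · rw [Expr.substEnv, trans, Term.subst, if_pos hki, if_pos hki, hs, List.getElem?_map]
      cases hi : ρ'[i - k]? with
      | none => simp [trans]
      | some e =>
        have hsc : (trans G e).Scoped 0 := by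
          refine hc _ ?_
          rw [hs]
          exact List.mem_map.2 ⟨_, List.mem_of_getElem? hi, rfl⟩
        simp [hsc.lift_eq]
    · exact ⟨.eRel i, by simp [Expr.substEnv, hki], by simp [trans, Term.subst, hki]⟩
  | eLambda x τ e ih =>
    simp only [Expr.closedAt, Expr.validIn, Bool.and_eq_true] at hn hv
    obtain ⟨τ', hτ, hτ'⟩ := Ty.exists_substEnv hρ hs hc hv.1 hn.1
    obtain ⟨e', he, he'⟩ := ih hv.2 hn.2
    exact ⟨.eLambda x τ' e', by simp [Expr.substEnv, hτ, he],
      by simp [trans, Term.subst, hτ', he']⟩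
  | eTyLam A e ih =>
    obtain ⟨e', he, he'⟩ := ih (k := k + 1) hv hn
    exact ⟨.eTyLam A e', by simp [Expr.substEnv, he], by simp [trans, Term.subst, he']⟩
  | eLetIn x τ e₁ e₂ ih₁ ih₂ =>
    simp only [Expr.closedAt, Expr.validIn, Bool.and_eq_true] at hn hv
    obtain ⟨τ', hτ, hτ'⟩ := Ty.exists_substEnv hρ hs hc hv.1.1 hn.1.1
    obtain ⟨e₁', he₁, he₁'⟩ := ih₁ hv.1.2 hn.1.2
    obtain ⟨e₂', he₂, he₂'⟩ := ih₂ hv.2 hn.2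
    exact ⟨.eLetIn x τ' e₁' e₂', by simp [Expr.substEnv, hτ, he₁, he₂],
      by simp [trans, Term.subst, hτ', he₁', he₂']⟩
  | eApp e₁ e₂ ih₁ ih₂ =>
    simp only [Expr.closedAt, Expr.validIn, Bool.and_eq_true] at hn hv
    obtain ⟨e₁', he₁, he₁'⟩ := ih₁ hv.1 hn.1
    obtain ⟨e₂', he₂, he₂'⟩ := ih₂ hv.2 hn.2
    exact ⟨.eApp e₁' e₂', by simp [Expr.substEnv, he₁, he₂],
      by simp [trans, Term.subst, he₁', he₂']⟩
  | eCase e I params σ bs ih ihb =>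
    simp only [Expr.closedAt, Expr.validIn, Bool.and_eq_true, List.all_eq_true,
      branchesClosedAt_iff, branchesValidIn_iff] at hn hv
    obtain ⟨⟨⟨hne, hnp⟩, hnσ⟩, hnb⟩ := hn
    obtain ⟨⟨⟨hve, hvp⟩, hvσ⟩, hvb⟩ := hv
    obtain ⟨σ', hσ, hσ'⟩ := Ty.exists_substEnv hρ hs hc hvσ hnσ
    obtain ⟨e', he, he'⟩ := ih hve hne
    obtain ⟨ps, hps, hps'⟩ := mapM_eq_some_map fun p hp =>
      Ty.exists_substEnv hρ hs hc (hvp p hp) (hnp p hp)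
    obtain ⟨bs', hbs, hbs'⟩ := exists_substEnvBranches fun b hb => ihb b hb (hvb b hb) (hnb b hb)
    have hpmap : ps.map transTy = (params.map transTy).map (Term.subst s k) := by
      clear hps hvp hnp
      induction hps' with
      | nil => rfl
      | cons h _ ih => simpa [h] using ih
    refine ⟨.eCase e' I ps σ' bs', by simp [Expr.substEnv, hσ, he, hps, hbs], ?_⟩
    rw [trans, trans]
    cases hd : resolveInd G I with
    | none => rfl
    | some d =>
      simp only [← hps'.length_eq]
      split_ifs with hlen
      · simp only [Term.subst, MetaCoq.subst_mkApps, MetaCoq.substBrs_eq_map, hpmap, he', hσ',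
          hbs', (scoped_transTy hnσ).subst_lift hc 1 (Nat.zero_le k), List.map_map, indTerm]
        congr 1
        refine List.map_congr_left fun c hcm => ?_
        refine subst_transBranch hc hnp ?_ hpmap
        rw [hlen]
        exact fun l => hG.scoped_args (mem_of_resolveInd hd) hcm
      · rfl
  | eConstr I C =>
    refine ⟨_, rfl, ?_⟩
    rw [trans]
    split <;> rfl
  | eFix f x τ₁ τ₂ e ih =>
    simp only [Expr.closedAt, Expr.validIn, Bool.and_eq_true] at hn hv
    obtain ⟨τ₁', h₁, h₁'⟩ := Ty.exists_substEnv hρ hs hc hv.1.1 hn.1.1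
    obtain ⟨τ₂', h₂, h₂'⟩ := Ty.exists_substEnv hρ hs hc hv.1.2 hn.1.2
    obtain ⟨e', he, he'⟩ := ih hv.2 hn.2
    refine ⟨.eFix f x τ₁' τ₂' e', by simp [Expr.substEnv, h₁, h₂, he], ?_⟩
    simp [trans, Term.subst, MetaCoq.substDefs, MetaCoq.substDef, h₁', h₂', he',
      (scoped_transTy hn.1.1).subst_lift hc 1 (Nat.zero_le k),
      (scoped_transTy hn.1.2).subst_lift hc 1 (Nat.zero_le k)]
  | eTy τ =>
    obtain ⟨τ', h, h'⟩ := Ty.exists_substEnv hρ hs hc hv hn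
    exact ⟨.eTy τ', by simp [Expr.substEnv, h], h'⟩

end Acorn

namespace Acorn

open MetaCoq (Term mkApps)

/-! Type values. -/

inductive Ty.IsValue : Ty → Prop
  | tyInd {I} : IsValue (.tyInd I)
  | tyForall {A τ} : τ.closedAt 1 = true → IsValue (.tyForall A τ)
  | tyApp {τ₁ τ₂} : τ₁.isIndApp = true → IsValue τ₁ → IsValue τ₂ → IsValue (.tyApp τ₁ τ₂)
  | tyArr {τ₁ τ₂} : τ₁.closedAt 0 = true → τ₂.closedAt 0 = true → IsValue (.tyArr τ₁ τ₂)

theorem Ty.closedAt_mono {τ : Ty} {m n : ℕ} (h : τ.closedAt m = true) (hmn : m ≤ n) :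
    τ.closedAt n = true := by
  induction τ generalizing m n with
  | tyInd => rfl
  | tyForall A τ ih => exact ih h (by omega : m + 1 ≤ n + 1)
  | tyApp τ₁ τ₂ ih₁ ih₂ | tyArr τ₁ τ₂ ih₁ ih₂ =>
    rw [Ty.closedAt, Bool.and_eq_true] at h ⊢
    exact ⟨ih₁ h.1 hmn, ih₂ h.2 hmn⟩
  | tyRel i =>
    simp only [Ty.closedAt, decide_eq_true_eq] at h ⊢
    omega

theorem Ty.validIn_of_closedAt {τ : Ty} {k : ℕ} (h : τ.closedAt k = true) (ρ : List Val) :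
    τ.validIn ρ k = true := by
  induction τ generalizing k with
  | tyInd => rfl
  | tyForall A τ ih => exact ih (k := k + 1) h
  | tyApp τ₁ τ₂ ih₁ ih₂ | tyArr τ₁ τ₂ ih₁ ih₂ =>
    rw [Ty.closedAt, Bool.and_eq_true] at h
    rw [Ty.validIn, Bool.and_eq_true]
    exact ⟨ih₁ h.1, ih₂ h.2⟩
  | tyRel i =>
    simp only [Ty.closedAt, decide_eq_true_eq] at h
    rw [Ty.validIn, if_neg (by omega)]

theorem Ty.IsValue.closedAt {τ : Ty} (h : τ.IsValue) : τ.closedAt 0 = true := by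
  induction h with
  | tyInd => rfl
  | tyForall h => exact h
  | tyApp _ _ _ ih₁ ih₂ => rw [Ty.closedAt, ih₁, ih₂]; rfl
  | tyArr h₁ h₂ => rw [Ty.closedAt, h₁, h₂]; rfl

theorem Ty.appHead_of_isIndApp {τ : Ty} (h : τ.isIndApp = true) :
    ∃ ind u, (transTy τ).appHead = .tInd ind u := by
  induction τ with
  | tyInd I => exact ⟨_, _, rfl⟩
  | tyApp τ₁ τ₂ ih₁ _ => exact ih₁ h
  | _ => simp [Ty.isIndApp] at h

theorem Ty.IsValue.eval_self {τ : Ty} (h : τ.IsValue) (E : MetaCoq.ConstEnv) :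
    MetaCoq.Eval E (transTy τ) (transTy τ) := by
  induction h with
  | tyApp h _ _ ih₁ ih₂ =>
    exact .appCong ih₁ (MetaCoq.not_redex_of_appHead (.inl (appHead_of_isIndApp h))) ih₂
  | _ => exact .atom trivial

theorem bind_eq_ok {α β : Type} {x : Res α} {f : α → Res β} {b : β} :
    (x >>= f) = .ok b ↔ ∃ a, x = .ok a ∧ f a = .ok b := by
  cases x <;> simp [bind, Except.bind]

theorem pure_eq_ok {α : Type} {a b : α} : (pure a : Res α) = .ok b ↔ a = b := by
  simp [pure, Except.pure]

theorem evalError_ne_ok {α : Type} {a : α} : (evalError : Res α) ≠ .ok a := by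
  simp [evalError]

/-- The translation of the read-back of a value (a dummy term if there is no read-back). -/
def transVal (G : GlobalEnv) (v : Val) : Term :=
  match fromVal v with
  | some e => trans G e
  | none => .tRel 0

theorem transVal_eq {G : GlobalEnv} {v : Val} {e : Expr} (h : fromVal v = some e) :
    transVal G v = trans G e := by
  rw [transVal, h]

theorem transVal_vTy {G : GlobalEnv} {τ : Ty} : transVal G (.vTy τ) = transTy τ := by
  simp [transVal, fromVal, trans]

/-- The outcome of the evaluation of a type agrees with the substitution of the environment. -/
theorem evalType_spec {G : GlobalEnv} {ρ : List Val}
    (hρ : ∀ τ, Val.vTy τ ∈ ρ → τ.closedAt 0 = true) (hc : ∀ v ∈ ρ, (transVal G v).Scoped 0)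
    {τ τ' : Ty} {k n : ℕ} (hn : τ.closedAt n = true) (h : evalType ρ k τ = .ok τ') :
    τ'.closedAt k = true ∧ transTy τ' = (transTy τ).subst (ρ.map (transVal G)) k := by
  induction τ generalizing k n τ' with
  | tyInd I =>
    rw [evalType, pure_eq_ok] at h
    subst h
    exact ⟨rfl, rfl⟩
  | tyForall A τ ih =>
    simp only [evalType, bind_eq_ok, pure_eq_ok] at h
    obtain ⟨τ₁, h, rfl⟩ := h
    obtain ⟨hc, ht⟩ := ih (n := n + 1) hn h
    exact ⟨hc, by simp [transTy, Term.subst, ht]⟩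
  | tyApp τ₁ τ₂ ih₁ ih₂ =>
    simp only [evalType, bind_eq_ok] at h
    obtain ⟨τ₂', h₂, τ₁', h₁, h⟩ := h
    split_ifs at h
    · rw [pure_eq_ok] at h
      subst h
      rw [Ty.closedAt, Bool.and_eq_true] at hn
      obtain ⟨hc₁, ht₁⟩ := ih₁ hn.1 h₁
      obtain ⟨hc₂, ht₂⟩ := ih₂ hn.2 h₂
      exact ⟨by simp [Ty.closedAt, hc₁, hc₂], by simp [transTy, Term.subst, ht₁, ht₂]⟩
    · exact absurd h evalError_ne_ok
  | tyRel i =>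
    rw [evalType] at h
    split_ifs at h with hki
    · split at h
      · next τ hτ =>
        rw [pure_eq_ok] at h
        subst h
        have hcl := hρ _ (List.mem_of_getElem? hτ)
        refine ⟨Ty.closedAt_mono hcl (Nat.zero_le _), ?_⟩
        rw [transTy, Term.subst, if_pos hki, List.getElem?_map, hτ]
        simp [transVal_vTy, (scoped_transTy hcl).lift_eq]
      · exact absurd h evalError_ne_ok
    · rw [pure_eq_ok] at h
      subst h
      exact ⟨by simpa [Ty.closedAt] using hki, by simp [transTy, Term.subst, hki]⟩
  | tyArr τ₁ τ₂ ih₁ ih₂ =>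
    simp only [evalType, bind_eq_ok, pure_eq_ok] at h
    obtain ⟨τ₂', h₂, τ₁', h₁, rfl⟩ := h
    rw [Ty.closedAt, Bool.and_eq_true] at hn
    obtain ⟨hc₁, ht₁⟩ := ih₁ hn.1 h₁
    obtain ⟨hc₂, ht₂⟩ := ih₂ hn.2 h₂
    refine ⟨by simp [Ty.closedAt, hc₁, hc₂], ?_⟩
    have := (scoped_transTy hn.2).subst_lift (s := ρ.map (transVal G)) (by simpa using hc) 1
      (Nat.zero_le k)
    simp [transTy, Term.subst, ht₁, ht₂, this]

theorem isValue_of_evalType {ρ : List Val} (hρ : ∀ τ, Val.vTy τ ∈ ρ → τ.IsValue) {τ τ' : Ty}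
    (hcl : τ'.closedAt 0 = true) (h : evalType ρ 0 τ = .ok τ') : τ'.IsValue := by
  induction τ generalizing τ' with
  | tyInd I =>
    rw [evalType, pure_eq_ok] at h
    subst h
    exact .tyInd
  | tyForall A τ ih =>
    simp only [evalType, bind_eq_ok, pure_eq_ok] at h
    obtain ⟨τ₁, h, rfl⟩ := h
    exact .tyForall hcl
  | tyApp τ₁ τ₂ ih₁ ih₂ =>
    simp only [evalType, bind_eq_ok] at h
    obtain ⟨τ₂', h₂, τ₁', h₁, h⟩ := h
    split_ifs at h with hi
    · rw [pure_eq_ok] at h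
      subst h
      rw [Ty.closedAt, Bool.and_eq_true] at hcl
      exact .tyApp hi (ih₁ hcl.1 h₁) (ih₂ hcl.2 h₂)
    · exact absurd h evalError_ne_ok
  | tyRel i =>
    rw [evalType, if_pos (Nat.zero_le _)] at h
    split at h
    · next τ hτ =>
      rw [pure_eq_ok] at h
      subst h
      exact hρ _ (List.mem_of_getElem? hτ)
    · exact absurd h evalError_ne_ok
  | tyArr τ₁ τ₂ ih₁ ih₂ =>
    simp only [evalType, bind_eq_ok, pure_eq_ok] at h
    obtain ⟨τ₂', h₂, τ₁', h₁, rfl⟩ := h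
    rw [Ty.closedAt, Bool.and_eq_true] at hcl
    exact .tyArr hcl.1 hcl.2

/-! Well-formed values. -/

inductive Val.Good (G : GlobalEnv) : Val → Prop
  | vConstr {I C args r} : resolveConstr G I C = some r → (∀ v ∈ args, Good G v) →
      Good G (.vConstr I C args)
  | vClosLam {ρ x τ e} : (∀ v ∈ ρ, Good G v) → τ.closedAt 0 = true →
      e.closedAt (ρ.length + 1) = true → e.validIn ρ 1 = true → Good G (.vClosLam ρ x τ e)
  | vClosFix {ρ f x τ₁ τ₂ e} : (∀ v ∈ ρ, Good G v) → τ₁.closedAt 0 = true →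
      τ₂.closedAt 0 = true → e.closedAt (ρ.length + 2) = true → e.validIn ρ 2 = true →
      Good G (.vClosFix ρ f x τ₁ τ₂ e)
  | vTyClos {ρ A e} : (∀ v ∈ ρ, Good G v) → e.closedAt (ρ.length + 1) = true →
      e.validIn ρ 1 = true → Good G (.vTyClos ρ A e)
  | vTy {τ} : τ.IsValue → Good G (.vTy τ)

theorem exists_fromVals {ρ : List Val} (G : GlobalEnv) (h : ∀ v ∈ ρ, ∃ e, fromVal v = some e) :
    ∃ ρ', fromVals ρ = some ρ' ∧ ReadBack ρ ρ' ∧ ρ.map (transVal G) = ρ'.map (trans G) := by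
  induction ρ with
  | nil => exact ⟨[], by simp [fromVals], .nil, rfl⟩
  | cons v ρ ih =>
    rw [List.forall_mem_cons] at h
    obtain ⟨e, he⟩ := h.1
    obtain ⟨ρ', hf, hr, hm⟩ := ih h.2
    exact ⟨e :: ρ', by simp [fromVals, he, hf], .cons he hr, by simp [hm, transVal_eq he]⟩

theorem exists_substEnv_of_fromVals {G : GlobalEnv} (hG : G.WellFormed) {ρ : List Val}
    (h : ∀ v ∈ ρ, (∃ e, fromVal v = some e) ∧ (transVal G v).Scoped 0) {a : Expr}
    (hn : a.closedAt ρ.length = true) (hv : a.validIn ρ 0 = true) :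
    ∃ ρ' e, fromVals ρ = some ρ' ∧ a.substEnv ρ' 0 = some e ∧
      trans G e = (trans G a).subst (ρ.map (transVal G)) 0 ∧ (trans G e).Scoped 0 := by
  obtain ⟨ρ', hf, hr, hm⟩ := exists_fromVals G fun v hv => (h v hv).1
  have hs : ∀ t ∈ ρ.map (transVal G), t.Scoped 0 := by
    rw [List.forall_mem_map]
    exact fun v hv => (h v hv).2
  obtain ⟨e, he, he'⟩ := Expr.exists_substEnv hG hr hm hs hv hn
  refine ⟨ρ', e, hf, he, he', ?_⟩
  rw [he']
  exact (scoped_trans hG hn).subst (k := 0) (by simp) hs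

theorem trans_foldl_eApp (G : GlobalEnv) (e : Expr) (es : List Expr) :
    trans G (es.foldl .eApp e) = mkApps (trans G e) (es.map (trans G)) := by
  induction es generalizing e with
  | nil => rfl
  | cons a es ih => simpa [mkApps, trans] using ih (.eApp e a)

theorem transVal_vConstr {G : GlobalEnv} {I C : String} {args : List Val} {np i : ℕ} {c : Ctor}
    (hr : resolveConstr G I C = some (np, i, c)) (h : ∀ v ∈ args, ∃ e, fromVal v = some e) :
    (∃ e, fromVal (.vConstr I C args) = some e) ∧ transVal G (.vConstr I C args) =
      mkApps (.tConstruct ⟨I, 0⟩ i []) (args.map (transVal G)) := by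
  obtain ⟨es, hf, -, hm⟩ := exists_fromVals G h
  have he : fromVal (.vConstr I C args) = some (es.foldl .eApp (.eConstr I C)) := by
    simp [fromVal, hf]
  refine ⟨⟨_, he⟩, ?_⟩
  rw [transVal_eq he, trans_foldl_eApp, hm, trans, hr]

theorem eval_mkApps_construct {E : MetaCoq.ConstEnv} {ind : MetaCoq.Ind} {i : ℕ}
    {u : List MetaCoq.Level} {l : List Term} (h : ∀ a ∈ l, MetaCoq.Eval E a a) :
    MetaCoq.Eval E (mkApps (.tConstruct ind i u) l) (mkApps (.tConstruct ind i u) l) := by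
  induction l using List.reverseRecOn with
  | nil => exact .atom trivial
  | append_singleton l a ih =>
    rw [MetaCoq.mkApps_concat]
    refine .appCong (ih fun b hb => h b (by simp [hb])) (MetaCoq.not_redex_of_appHead (.inr ?_))
      (h a (by simp))
    exact ⟨_, _, _, MetaCoq.appHead_mkApps _ _⟩

theorem Val.Good.readBack {G : GlobalEnv} (hG : G.WellFormed) {v : Val} (h : v.Good G) :
    (∃ e, fromVal v = some e) ∧ (transVal G v).Scoped 0 := by
  induction h with
  | @vConstr I C args r hr _ ih =>
    obtain ⟨np, i, c⟩ := r
    obtain ⟨he, ht⟩ := transVal_vConstr hr fun v hv => (ih v hv).1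
    refine ⟨he, ?_⟩
    rw [ht]
    refine MetaCoq.scoped_mkApps .tConstruct ?_
    rw [List.forall_mem_map]
    exact fun v hv => (ih v hv).2
  | @vClosLam ρ x τ e _ hτ hn hv ih =>
    obtain ⟨ρ', e', hf, he, -, hs⟩ := exists_substEnv_of_fromVals (a := .eLambda x τ e) hG ih
      (by simp [Expr.closedAt, Ty.closedAt_mono hτ (Nat.zero_le _), hn])
      (by simp [Expr.validIn, Ty.validIn_of_closedAt hτ, hv])
    have hfv : fromVal (.vClosLam ρ x τ e) = some e' := by simp [fromVal, hf, he]
    exact ⟨⟨_, hfv⟩, by rwa [transVal_eq hfv]⟩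
  | @vClosFix ρ f x τ₁ τ₂ e _ h₁ h₂ hn hv ih =>
    obtain ⟨ρ', e', hf, he, -, hs⟩ := exists_substEnv_of_fromVals (a := .eFix f x τ₁ τ₂ e) hG ih
      (by simp [Expr.closedAt, Ty.closedAt_mono h₁ (Nat.zero_le _),
        Ty.closedAt_mono h₂ (Nat.zero_le _), hn])
      (by simp [Expr.validIn, Ty.validIn_of_closedAt h₁, Ty.validIn_of_closedAt h₂, hv])
    have hfv : fromVal (.vClosFix ρ f x τ₁ τ₂ e) = some e' := by simp [fromVal, hf, he]
    exact ⟨⟨_, hfv⟩, by rwa [transVal_eq hfv]⟩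
  | @vTyClos ρ A e _ hn hv ih =>
    obtain ⟨ρ', e', hf, he, -, hs⟩ := exists_substEnv_of_fromVals (a := .eTyLam A e) hG ih hn hv
    have hfv : fromVal (.vTyClos ρ A e) = some e' := by simp [fromVal, hf, he]
    exact ⟨⟨_, hfv⟩, by rwa [transVal_eq hfv]⟩
  | vTy h =>
    refine ⟨⟨_, by rw [fromVal]⟩, ?_⟩
    rw [transVal_vTy]
    exact scoped_transTy h.closedAt

theorem transVal_vClosLam {G : GlobalEnv} (hG : G.WellFormed) {ρ : List Val} {x : String} {τ : Ty}
    {e : Expr} (h : (Val.vClosLam ρ x τ e).Good G) :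
    transVal G (.vClosLam ρ x τ e) =
      .tLambda (.nNamed x) (transTy τ) ((trans G e).subst (ρ.map (transVal G)) 1) := by
  obtain _ | ⟨hρ, hτ, hn, hv⟩ := h
  obtain ⟨ρ', e', hf, he, ht, -⟩ := exists_substEnv_of_fromVals (a := .eLambda x τ e) hG
    (fun v hv => (hρ v hv).readBack hG)
    (by simp [Expr.closedAt, Ty.closedAt_mono hτ (Nat.zero_le _), hn])
    (by simp [Expr.validIn, Ty.validIn_of_closedAt hτ, hv])
  rw [transVal_eq (e := e') (by simp [fromVal, hf, he]), ht, trans, Term.subst,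
    (scoped_transTy hτ).subst_eq _ le_rfl]

theorem transVal_vTyClos {G : GlobalEnv} (hG : G.WellFormed) {ρ : List Val} {A : String}
    {e : Expr} (h : (Val.vTyClos ρ A e).Good G) :
    transVal G (.vTyClos ρ A e) =
      .tLambda (.nNamed A) (.tSort .set) ((trans G e).subst (ρ.map (transVal G)) 1) := by
  obtain _ | _ | _ | ⟨hρ, hn, hv⟩ := h
  obtain ⟨ρ', e', hf, he, ht, -⟩ := exists_substEnv_of_fromVals (a := .eTyLam A e) hG
    (fun v hv => (hρ v hv).readBack hG) hn hv
  rw [transVal_eq (e := e') (by simp [fromVal, hf, he]), ht, trans, Term.subst, Term.subst]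

theorem transVal_vClosFix {G : GlobalEnv} (hG : G.WellFormed) {ρ : List Val} {f x : String}
    {τ₁ τ₂ : Ty} {e : Expr} (h : (Val.vClosFix ρ f x τ₁ τ₂ e).Good G) :
    transVal G (.vClosFix ρ f x τ₁ τ₂ e) =
      .tFix [{ dname := .nNamed f
               dtype := .tProd .nAnon (transTy τ₁) (transTy τ₂)
               dbody := .tLambda (.nNamed x) (transTy τ₁)
                ((trans G e).subst (ρ.map (transVal G)) 2)
               rarg := 0 }] 0 := by
  obtain _ | _ | ⟨hρ, h₁, h₂, hn, hv⟩ := h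
  obtain ⟨ρ', e', hf, he, ht, -⟩ := exists_substEnv_of_fromVals (a := .eFix f x τ₁ τ₂ e) hG
    (fun v hv => (hρ v hv).readBack hG)
    (by simp [Expr.closedAt, Ty.closedAt_mono h₁ (Nat.zero_le _),
      Ty.closedAt_mono h₂ (Nat.zero_le _), hn])
    (by simp [Expr.validIn, Ty.validIn_of_closedAt h₁, Ty.validIn_of_closedAt h₂, hv])
  rw [transVal_eq (e := e') (by simp [fromVal, hf, he]), ht]
  simp [trans, Term.subst, MetaCoq.substDefs, MetaCoq.substDef,
    (scoped_transTy h₁).lift_eq, (scoped_transTy h₂).lift_eq, (scoped_transTy h₁).subst_eq,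
    (scoped_transTy h₂).subst_eq]

theorem Val.Good.eval_self {G : GlobalEnv} (hG : G.WellFormed) (E : MetaCoq.ConstEnv) {v : Val}
    (h : v.Good G) : MetaCoq.Eval E (transVal G v) (transVal G v) := by
  induction h with
  | @vConstr I C args r hr ha ih =>
    obtain ⟨np, i, c⟩ := r
    rw [(transVal_vConstr hr fun v hv => ((ha v hv).readBack hG).1).2]
    refine eval_mkApps_construct ?_
    rw [List.forall_mem_map]
    exact ih
  | vClosLam hρ hτ hn hv =>
    rw [transVal_vClosLam hG (.vClosLam hρ hτ hn hv)]
    exact .atom trivial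
  | vClosFix hρ h₁ h₂ hn hv =>
    rw [transVal_vClosFix hG (.vClosFix hρ h₁ h₂ hn hv)]
    exact .atom trivial
  | vTyClos hρ hn hv =>
    rw [transVal_vTyClos hG (.vTyClos hρ hn hv)]
    exact .atom trivial
  | vTy h =>
    rw [transVal_vTy]
    exact h.eval_self E

end Acorn

namespace Acorn

open MetaCoq (Term mkApps)

theorem resolveConstr_eq_some {G : GlobalEnv} {I C : String} {r : ℕ × ℕ × Ctor}
    (h : resolveConstr G I C = some r) :
    ∃ d, resolveInd G I = some d ∧ d.nparams = r.1 ∧ findCtor d.ctors C = some r.2 := by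
  rw [resolveConstr] at h
  split at h
  · simp at h
  · next d hd =>
    obtain ⟨p, hp, rfl⟩ := Option.map_eq_some_iff.1 h
    exact ⟨d, hd, rfl, hp⟩

theorem findCtor_eq_some {cs : List Ctor} {C : String} {i : ℕ} {c : Ctor}
    (h : findCtor cs C = some (i, c)) : cs[i]? = some c ∧ c.name = C := by
  induction cs generalizing i with
  | nil => simp [findCtor] at h
  | cons c' cs ih =>
    rw [findCtor] at h
    split_ifs at h with hC
    · simp only [Option.some.injEq, Prod.mk.injEq] at h
      obtain ⟨rfl, rfl⟩ := h
      exact ⟨rfl, hC⟩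
    · obtain ⟨⟨j, c₁⟩, hp, heq⟩ := Option.map_eq_some_iff.1 h
      obtain ⟨rfl, rfl⟩ := Prod.mk.inj heq
      simpa using ih hp

/-- Evaluation in a good environment yields a good value, and the translation of the expression,
closed by the environment, evaluates to the translation of the value. -/
theorem eval_sound {G : GlobalEnv} (hG : G.WellFormed) (E : MetaCoq.ConstEnv) {n : ℕ}
    {ρ : List Val} {e : Expr} {v : Val} (hρ : ∀ w ∈ ρ, w.Good G)
    (he : e.closedAt ρ.length = true) (hv : eval G n ρ e = .ok v) :
    v.Good G ∧
      MetaCoq.Eval E ((trans G e).subst (ρ.map (transVal G)) 0) (transVal G v) := by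
  induction n generalizing ρ e v with
  | zero => simp [eval] at hv
  | succ n ih =>
    have hsc : ∀ w ∈ ρ, (transVal G w).Scoped 0 := fun w hw => ((hρ w hw).readBack hG).2
    have hty : ∀ τ, Val.vTy τ ∈ ρ → τ.IsValue := fun τ hτ => by
      obtain _ | _ | _ | _ | h := hρ _ hτ
      exact h
    have htype : ∀ {τ τ'}, τ.closedAt ρ.length = true → evalType ρ 0 τ = .ok τ' →
        τ'.IsValue ∧ transTy τ' = (transTy τ).subst (ρ.map (transVal G)) 0 := fun hn h => by
      obtain ⟨hc, ht⟩ := evalType_spec (fun τ hτ => (hty τ hτ).closedAt) hsc hn h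
      exact ⟨isValue_of_evalType hty hc h, ht⟩
    have hmap : ∀ {ρ' : List Val}, (∀ w ∈ ρ', w.Good G) →
        ∀ t ∈ ρ'.map (transVal G), t.Scoped 0 := fun h => by
      rw [List.forall_mem_map]
      exact fun w hw => ((h w hw).readBack hG).2
    have hbeta : ∀ {b : Expr} {ρ' : List Val} {w : Val}, (∀ w ∈ ρ', w.Good G) →
        b.closedAt (ρ'.length + 1) = true →
        ((trans G b).subst (ρ'.map (transVal G)) 1).subst [transVal G w] 0 =
          (trans G b).subst ((w :: ρ').map (transVal G)) 0 := fun h hb =>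
      (scoped_trans hG hb).subst_append (hmap h) rfl
    cases e with
    | eRel i =>
      simp only [eval] at hv
      split at hv
      · next w hw =>
        rw [pure_eq_ok] at hv
        subst hv
        have hmem := List.mem_of_getElem? hw
        refine ⟨hρ _ hmem, ?_⟩
        rw [trans, Term.subst, if_pos (Nat.zero_le _), List.getElem?_map, Nat.sub_zero, hw]
        simp only [Option.map_some]
        rw [(hsc _ hmem).lift_eq _ le_rfl]
        exact (hρ _ hmem).eval_self hG E
      · exact absurd hv evalError_ne_ok
    | eLambda x τ b =>
      simp only [eval, bind_eq_ok, validate] at hv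
      obtain ⟨τ', hτ, _, hval, hv⟩ := hv
      split_ifs at hval with hb
      · rw [pure_eq_ok] at hv
        subst hv
        rw [Expr.closedAt, Bool.and_eq_true] at he
        obtain ⟨hτ', ht⟩ := htype he.1 hτ
        have hgood : (Val.vClosLam ρ x τ' b).Good G := .vClosLam hρ hτ'.closedAt he.2 hb
        refine ⟨hgood, ?_⟩
        rw [transVal_vClosLam hG hgood, ht]
        exact .atom trivial
      · exact absurd hval evalError_ne_ok
    | eTyLam A b =>
      simp only [eval, bind_eq_ok, validate] at hv
      obtain ⟨_, hval, hv⟩ := hv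
      split_ifs at hval with hb
      · rw [pure_eq_ok] at hv
        subst hv
        have hgood : (Val.vTyClos ρ A b).Good G := .vTyClos hρ he hb
        refine ⟨hgood, ?_⟩
        rw [transVal_vTyClos hG hgood]
        exact .atom trivial
      · exact absurd hval evalError_ne_ok
    | eLetIn x τ e₁ e₂ =>
      simp only [eval, bind_eq_ok] at hv
      obtain ⟨_, _, v₁, h₁, h₂⟩ := hv
      simp only [Expr.closedAt, Bool.and_eq_true] at he
      obtain ⟨hg₁, hev₁⟩ := ih hρ he.1.2 h₁
      obtain ⟨hg₂, hev₂⟩ := ih (List.forall_mem_cons.2 ⟨hg₁, hρ⟩) (by simpa using he.2) h₂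
      refine ⟨hg₂, ?_⟩
      rw [trans, Term.subst]
      refine .zeta hev₁ ?_
      rwa [hbeta hρ he.2]
    | eApp e₁ e₂ =>
      simp only [eval, bind_eq_ok] at hv
      obtain ⟨v₂, h₂, v₁, h₁, hv⟩ := hv
      rw [Expr.closedAt, Bool.and_eq_true] at he
      obtain ⟨hg₁, hev₁⟩ := ih hρ he.1 h₁
      obtain ⟨hg₂, hev₂⟩ := ih hρ he.2 h₂
      rw [trans, Term.subst]
      split at hv
      · next I C args =>
        rw [pure_eq_ok] at hv
        subst hv
        obtain @⟨_, _, _, ⟨np, i, c⟩, hr, hargs⟩ := hg₁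
        have hargs' : ∀ w ∈ args ++ [v₂], w.Good G := by
          simp only [List.mem_append, List.mem_singleton]
          rintro w (hw | rfl)
          · exact hargs w hw
          · exact hg₂
        refine ⟨.vConstr hr hargs', ?_⟩
        rw [(transVal_vConstr hr fun w hw => ((hargs w hw).readBack hG).1).2] at hev₁
        rw [(transVal_vConstr hr fun w hw => ((hargs' w hw).readBack hG).1).2, List.map_append,
          List.map_singleton, MetaCoq.mkApps_concat]
        exact .appCong hev₁ (MetaCoq.not_redex_of_appHead
          (.inr ⟨_, _, _, MetaCoq.appHead_mkApps _ _⟩)) hev₂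
      · rw [transVal_vClosLam hG hg₁] at hev₁
        obtain _ | ⟨hρ', _, hn, _⟩ := hg₁
        obtain ⟨hg, hev⟩ := ih (List.forall_mem_cons.2 ⟨hg₂, hρ'⟩) (by simpa using hn) hv
        refine ⟨hg, .beta hev₁ hev₂ ?_⟩
        rwa [hbeta hρ' hn]
      · next ρ' f x τ₁ τ₂ b =>
        split_ifs at hv with hconstr
        · have hfix := transVal_vClosFix hG hg₁
          have hg₁' := hg₁
          obtain _ | _ | ⟨hρ', _, _, hn, _⟩ := hg₁'
          have hρ₁ := List.forall_mem_cons.2 ⟨hg₁, hρ'⟩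
          obtain ⟨hg, hev⟩ := ih (List.forall_mem_cons.2 ⟨hg₂, hρ₁⟩) (by simpa using hn) hv
          refine ⟨hg, ?_⟩
          rw [hfix] at hev₁
          refine .fix (args := []) hev₁ hev₂ rfl ⟨_, rfl, ?_⟩ ?_
          · obtain @⟨I, C, args, ⟨np, i, c⟩, hr, hargs⟩ | _ | _ | _ | _ := hg₂
            · rw [(transVal_vConstr hr fun w hw => ((hargs w hw).readBack hG).1).2]
              exact ⟨_, _, _, MetaCoq.appHead_mkApps _ _⟩
            all_goals simp [Val.isConstr] at hconstr
          · refine .beta (.atom trivial) (hg₂.eval_self hG E) ?_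
            rw [MetaCoq.fixSubst_singleton, ← hfix]
            have hfun := (scoped_trans hG hn).subst_append (k := 1)
              (a := [transVal G (.vClosFix ρ' f x τ₁ τ₂ b)]) (hmap hρ') rfl
            have harg := (scoped_trans hG hn).subst_append (k := 0) (a := [transVal G v₂])
              (hmap hρ₁) rfl
            exact (congrArg _ hfun).trans harg ▸ hev
        · exact absurd hv evalError_ne_ok
      · rw [transVal_vTyClos hG hg₁] at hev₁
        obtain _ | _ | _ | ⟨hρ', hn, _⟩ := hg₁
        obtain ⟨hg, hev⟩ := ih (List.forall_mem_cons.2 ⟨hg₂, hρ'⟩) (by simpa using hn) hv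
        refine ⟨hg, .beta hev₁ hev₂ ?_⟩
        rwa [hbeta hρ' hn]
      · exact absurd hv evalError_ne_ok
    | eCase e I params σ bs =>
      simp only [eval, bind_eq_ok] at hv
      obtain ⟨_, _, _, _, _, _, v₁, h₁, hv⟩ := hv
      simp only [Expr.closedAt, Bool.and_eq_true, List.all_eq_true, branchesClosedAt_iff] at he
      obtain ⟨⟨⟨hne, hnp⟩, -⟩, hnb⟩ := he
      obtain ⟨hg₁, hev₁⟩ := ih hρ hne h₁
      split at hv
      · next I' C args =>
        split at hv
        · next np i c hr =>
          split_ifs at hv with hcond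
          · obtain ⟨rfl, hlen⟩ := hcond
            rw [bind_eq_ok] at hv
            obtain ⟨b, hb, hv⟩ := hv
            obtain ⟨d, hd, hdn, hfind⟩ := resolveConstr_eq_some hr
            obtain ⟨hci, hcn⟩ := findCtor_eq_some hfind
            simp only at hdn
            have hargs : ∀ w ∈ args, w.Good G := by
              obtain ⟨_, h⟩ := hg₁
              exact h
            rw [matchPat] at hb
            split at hb
            · exact absurd hb evalError_ne_ok
            · next p b' hpb =>
              split_ifs at hb with hl
              · rw [pure_eq_ok] at hb
                subst hb
                have hmem := List.mem_of_find?_eq_some hpb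
                have hnb' := hnb _ hmem
                simp only at hnb'
                have hρ' : ∀ w ∈ (args.drop np).reverse ++ ρ, w.Good G := by
                  intro w hw
                  rw [List.mem_append, List.mem_reverse] at hw
                  exact hw.elim (fun h => hargs w (List.mem_of_mem_drop h)) (hρ w)
                have hdrop : (args.drop np).length = p.vars.length := by
                  rw [List.length_drop, hl.1, Nat.add_sub_cancel_left]
                obtain ⟨hg, hev⟩ := ih hρ' (by
                  rw [List.length_append, List.length_reverse, hdrop, Nat.add_comm]
                  exact hnb') hv
                refine ⟨hg, ?_⟩
                rw [(transVal_vConstr hr fun w hw => ((hargs w hw).readBack hG).1).2] at hev₁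
                have hbr : transBranch params (transBodies G bs) c =
                    (p.vars.length, patLambdas (params.map transTy).reverse
                      (p.vars.zip (c.args.map transTy)) (trans G b')) := by
                  rw [transBranch, transBodies_eq_map, List.find?_map, hcn]
                  have : ((fun b : Pat × Term => b.1.ctor == C) ∘
                      fun b : Pat × Expr => (b.1, trans G b.2)) = fun b => b.1.ctor == C := rfl
                  rw [this, hpb]
                  exact if_pos (Nat.add_left_cancel (hl.1.symm.trans hl.2))
                have hzip : (p.vars.zip (c.args.map transTy)).length = p.vars.length := by
                  rw [List.length_zip, List.length_map,
                    ← Nat.add_left_cancel (hl.1.symm.trans hl.2), Nat.min_self]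
                rw [trans, hd]
                simp only
                rw [if_pos (hlen.trans hdn.symm), Term.subst, MetaCoq.substBrs_eq_map]
                refine .iota (br := (p.vars.length, (patLambdas (params.map transTy).reverse
                  (p.vars.zip (c.args.map transTy)) (trans G b')).subst
                    (ρ.map (transVal G)) 0)) hev₁ (by simp [hci, hbr]) ?_
                have hlams := (isLambdas_patLambdas (params.map transTy).reverse
                  (p.vars.zip (c.args.map transTy)) (trans G b')).subst (ρ.map (transVal G)) 0
                rw [hzip, Nat.zero_add] at hlams
                have hbody : ((trans G b').subst (ρ.map (transVal G)) p.vars.length).subst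
                    ((args.drop np).map (transVal G)).reverse 0 =
                      (trans G b').subst (((args.drop np).reverse ++ ρ).map (transVal G)) 0 := by
                  rw [(scoped_trans hG hnb').subst_append (hmap hρ) (by simp [← hdrop]),
                    List.map_append, List.map_reverse]
                have hscope : ((trans G b').subst (ρ.map (transVal G)) p.vars.length).Scoped
                    p.vars.length :=
                  ((scoped_trans hG hnb').subst (by simp) (hmap hρ)).mono (by omega)
                rw [← hbody] at hev
                simp only [hdn, ← List.map_drop]
                cases hk : p.vars.length with
                | zero =>
                  rw [hk] at hlams hdrop hev
                  rw [List.length_eq_zero_iff] at hdrop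
                  rw [hdrop] at hev ⊢
                  generalize Term.subst _ _ (patLambdas _ _ _) = T at hlams ⊢
                  cases hlams
                  simpa [mkApps, (hk ▸ hscope : Term.Scoped 0 _).subst_eq _ le_rfl] using hev
                | succ k =>
                  rw [hk] at hlams hdrop hev hscope
                  refine MetaCoq.Eval.mkApps_lambdas hlams ?_ (by simpa using hdrop) hscope ?_ ?_ hev
                  · generalize Term.subst _ _ (patLambdas _ _ _) = T at hlams ⊢
                    cases hlams
                    exact .atom trivial
                  · rw [List.forall_mem_map]
                    exact fun w hw => (hargs w (List.mem_of_mem_drop hw)).eval_self hG E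
                  · exact hmap fun w hw => hargs w (List.mem_of_mem_drop hw)
              · exact absurd hb evalError_ne_ok
          · exact absurd hv evalError_ne_ok
        · exact absurd hv evalError_ne_ok
      · exact absurd hv evalError_ne_ok
    | eConstr I C =>
      simp only [eval] at hv
      split at hv
      · next r hr =>
        rw [pure_eq_ok] at hv
        subst hv
        obtain ⟨np, i, c⟩ := r
        refine ⟨.vConstr hr (by simp), ?_⟩
        rw [(transVal_vConstr hr (by simp)).2, trans, hr]
        exact .atom trivial
      · exact absurd hv evalError_ne_ok
    | eFix f x τ₁ τ₂ b =>
      simp only [eval, bind_eq_ok, validate] at hv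
      obtain ⟨τ₁', h₁, τ₂', h₂, _, hval, hv⟩ := hv
      split_ifs at hval with hb
      · rw [pure_eq_ok] at hv
        subst hv
        simp only [Expr.closedAt, Bool.and_eq_true] at he
        obtain ⟨hτ₁, ht₁⟩ := htype he.1.1 h₁
        obtain ⟨hτ₂, ht₂⟩ := htype he.1.2 h₂
        have hgood : (Val.vClosFix ρ f x τ₁' τ₂' b).Good G :=
          .vClosFix hρ hτ₁.closedAt hτ₂.closedAt he.2 hb
        refine ⟨hgood, ?_⟩
        have hlift : ∀ {τ τ' : Ty}, τ.closedAt ρ.length = true → τ'.IsValue →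
            transTy τ' = (transTy τ).subst (ρ.map (transVal G)) 0 →
            ((transTy τ).lift 1 0).subst (ρ.map (transVal G)) 1 = transTy τ' := by
          intro τ τ' hn hτ' ht
          rw [(scoped_transTy hn).subst_lift (hmap hρ) 1 (k := 0) le_rfl, ← ht,
            (scoped_transTy hτ'.closedAt).lift_eq _ le_rfl]
        rw [transVal_vClosFix hG hgood, trans]
        simp only [Term.subst, MetaCoq.substDefs, MetaCoq.substDef, List.length_singleton,
          Nat.zero_add, hlift he.1.1 hτ₁ ht₁, hlift he.1.2 hτ₂ ht₂, ← ht₁]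
        exact .atom trivial
      · exact absurd hval evalError_ne_ok
    | eTy τ =>
      simp only [eval, bind_eq_ok, pure_eq_ok] at hv
      obtain ⟨τ', hτ, rfl⟩ := hv
      obtain ⟨hτ', ht⟩ := htype he hτ
      refine ⟨.vTy hτ', ?_⟩
      rw [transVal_vTy, trans, ← ht]
      exact hτ'.eval_self E

end Acorn

theorem mainTheorem3 (G : Acorn.GlobalEnv) (hG : G.WellFormed) (E : MetaCoq.ConstEnv)
    (e : Acorn.Expr) (he : e.Closed) (n : ℕ) (v : Acorn.Val)
    (hv : Acorn.eval G n [] e = .ok v) :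
    ∃ e' : Acorn.Expr, Acorn.fromVal v = some e' ∧
      MetaCoq.Eval E (Acorn.trans G e) (Acorn.trans G e') := by
  obtain ⟨hgood, hev⟩ := Acorn.eval_sound (ρ := []) hG E (by simp) he hv
  obtain ⟨⟨e', he'⟩, -⟩ := hgood.readBack hG
  refine ⟨e', he', ?_⟩
  rwa [(Acorn.scoped_trans hG he).subst_eq _ le_rfl, Acorn.transVal_eq he'] at hev
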